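/- For $z,w\in\mathbb C$ write $z\preceq w$ if $\Im z<\Im w$, or $\Im z=\Im w$ and $\Re z\le\Re w$. For each $n$ let $\phi_1,\dots,\phi_n$ be independent random points, uniformly distributed in the unit disk $D(0,1)\subset\mathbb C$, and consider the point process on $[0,\infty)\times\mathbb C$ \[ \widehat\chi^{(n)}=\sum_{i}\delta_{(n|\phi_{i^*}-\phi_i|,\ \phi_i)},\qquad |\phi_{i^*}-\phi_i|=\min\{|\phi_j-\phi_i| : j\ne i,\ \phi_j\succeq\phi_i\}, \] where the sum is over those $i\in\{1,\dots,n\}$ for which there is some $j\neq i$ with $\phi_j\succeq\phi_i$ (almost surely, all but the largest point). Then, as $n\to\infty$, $\widehat\chi^{(n)}$ converges weakly (in distribution, as random elements of the space of locally finite measures on $[0,\infty)\times\mathbb C$ with the vague topology) to a Poisson point process $\widehat\chi$ on $[0,\infty)\times\mathbb C$ whose intensity is given by \[ \mathbb E\,\widehat\chi(A\times I)=\frac{|I\cap D(0,1)|}{\pi}\int_A r\,dr \] for all bounded Borel sets $A\subset[0,\infty)$ and $I\subset\mathbb C$, where $|\cdot|$ denotes Lebesgue measure. -/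

import Mathlib

open MeasureTheory ProbabilityTheory Filter Topology
open scoped NNReal ENNReal CompactlySupported

noncomputable section

/-! ### Random measures and the vague topology -/

/-- The space of locally finite Borel measures on `X`. A point process on `X` is a random element
of this space which is a sum of Dirac masses. -/
def LocallyFiniteMeasure (X : Type*) [TopologicalSpace X] [MeasurableSpace X] : Type _ :=
  {μ : Measure X // IsLocallyFiniteMeasure μ}

namespace LocallyFiniteMeasure

variable {X : Type*} [TopologicalSpace X] [MeasurableSpace X]

/-- The underlying measure. -/
def toMeasure (μ : LocallyFiniteMeasure X) : Measure X := μ.1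

/-- The vague topology: the coarsest topology for which `μ ↦ ∫ f dμ` is continuous for every
continuous compactly supported function `f : X → ℝ`. -/
instance : TopologicalSpace (LocallyFiniteMeasure X) :=
  ⨅ f : C_c(X, ℝ), TopologicalSpace.induced (fun μ => ∫ x, f x ∂μ.toMeasure) inferInstance

/-- The Borel σ-algebra of the vague topology. -/
instance : MeasurableSpace (LocallyFiniteMeasure X) := borel _

instance : BorelSpace (LocallyFiniteMeasure X) := ⟨rfl⟩

end LocallyFiniteMeasure

/-- `χ` is a Poisson point process with intensity measure `Λ` under `P`: the number of points in
a measurable set of finite intensity is Poisson distributed with mean the intensity, and the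
numbers of points in finitely many disjoint such sets are independent. -/
structure IsPoissonPointProcess {X Ω : Type*} [TopologicalSpace X] [MeasurableSpace X]
    [MeasurableSpace Ω] (χ : Ω → LocallyFiniteMeasure X) (Λ : Measure X) (P : Measure Ω) :
    Prop where
  aemeasurable : AEMeasurable χ P
  hasLaw_count : ∀ B : Set X, MeasurableSet B → Λ B ≠ ∞ →
    HasLaw (fun ω => (χ ω).toMeasure B)
      ((poissonMeasure (Λ B).toNNReal).map (fun k : ℕ => (k : ℝ≥0∞))) P
  iIndepFun_count : ∀ (k : ℕ) (B : Fin k → Set X), (∀ i, MeasurableSet (B i)) →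
    (∀ i, Λ (B i) ≠ ∞) → Pairwise (fun i j => Disjoint (B i) (B j)) →
    iIndepFun (fun i ω => (χ ω).toMeasure (B i)) P

/-! ### The process of rescaled gaps -/

/-- The lexicographic order on `ℂ`: imaginary parts are compared first, then real parts. -/
def LexLE (z w : ℂ) : Prop := z.im < w.im ∨ (z.im = w.im ∧ z.re ≤ w.re)

open Classical in
/-- The indices `j ≠ i` of the points `p j` with `p j ⪰ p i`. -/
def lexSuccessors {n : ℕ} (p : Fin n → ℂ) (i : Fin n) : Finset (Fin n) :=
  Finset.univ.filter fun j => j ≠ i ∧ LexLE (p i) (p j)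

/-- The distance from `p i` to the nearest among the other points that are `⪰ p i`. -/
def lexGap {n : ℕ} (p : Fin n → ℂ) (i : Fin n) (h : (lexSuccessors p i).Nonempty) : ℝ≥0 :=
  (lexSuccessors p i).inf' h fun j => nndist (p i) (p j)

open Classical in
/-- The sum of the Dirac masses at `(n * gap of p i, p i)`, over the indices `i` whose gap is
defined, that is, for which there is some other point `⪰ p i`. -/
def gapMeasure {n : ℕ} (p : Fin n → ℂ) : Measure (ℝ≥0 × ℂ) :=
  ∑ i : Fin n, if h : (lexSuccessors p i).Nonempty then
    Measure.dirac ((n : ℝ≥0) * lexGap p i h, p i) else 0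

instance {n : ℕ} (p : Fin n → ℂ) : IsFiniteMeasure (gapMeasure p) := by
  classical
  unfold gapMeasure
  have h : ∀ s : Finset (Fin n), IsFiniteMeasure (∑ i ∈ s,
      if h : (lexSuccessors p i).Nonempty then
        Measure.dirac ((n : ℝ≥0) * lexGap p i h, p i) else 0) := by
    intro s
    induction s using Finset.induction_on with
    | empty => simpa using (inferInstance : IsFiniteMeasure (0 : Measure (ℝ≥0 × ℂ)))
    | insert a s ha ih =>
      rw [Finset.sum_insert ha]
      split_ifs <;> infer_instance
  exact h _

/-- The point process of rescaled gaps on `[0, ∞) × ℂ`, as a function of the points. -/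
def gapProcess {n : ℕ} (p : Fin n → ℂ) : LocallyFiniteMeasure (ℝ≥0 × ℂ) :=
  ⟨gapMeasure p, inferInstance⟩

/-- The measure `r dr ⊗ π⁻¹ 𝟙_{D(0,1)}(v) dv` on `[0, ∞) × ℂ`. -/
def gapIntensity : Measure (ℝ≥0 × ℂ) :=
  (((volume.restrict (Set.Ici (0 : ℝ))).withDensity fun r => ENNReal.ofReal r).map
    Real.toNNReal).prod
    ((ENNReal.ofReal Real.pi)⁻¹ • (volume.restrict (Metric.ball (0 : ℂ) 1)))

end

/-!
The proof compares characteristic functionals: for a continuous compactly supported `f`, it shows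
that `E exp (i ∫ f dχₙ)` converges to `exp (∫ (exp (i f) - 1) dΛ)`, where `χₙ` is the gap process
and `Λ` is `gapIntensity`.

**Why the limit is Poisson.** With `f (r, z) = 0` for `r > R`, only pairs of points at distance at
most `R / n` matter. There are of order one such pairs, and the expected number of points that
belong to two of them is of order `1 / n`. Off this event the nearest successor of a point is the
only successor that contributes, and `∫ f dχₙ` is the sum of the kernel `gapKernel f n` over all
pairs (`integral_gapMeasure_eq_pairSum`). For such sums the points are added one by one: a new point
multiplies the characteristic function of the sum over `m` points by `1 + m γ` up to an error of
order `m² q²`, where `γ` is the mean of the factor `exp (i h) - 1` of an unordered pair and `q`, of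
order `n⁻²`, bounds the conditional mean of its modulus given one of the points. Replacing `1 + m γ`
by `exp (m γ)`, which has modulus at most one, and summing the errors gives
`exp (n (n - 1) / 2 * γ)` up to `O (1 / n)` (`norm_pairCharFun_sub_exp_le`). The substitution
`b = a + u / n`, dominated convergence, the symmetry of the half-plane `0 ⪯ u` under reflection, and
polar coordinates give `n (n - 1) / 2 * γ → ∫ (exp (i f) - 1) dΛ`
(`tendsto_integral_pairFactor_gapKernel`).

**Why characteristic functionals suffice.** On a proper metric space the vague topology is induced
by countably many test functions (`LocallyFiniteMeasure.exists_isInducing`). An open set is then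
an increasing union of sets described by finitely many of these integrals, for which Lévy's theorem
gives the portmanteau inequality; no tightness argument is needed
(`tendsto_probabilityMeasure_of_isInducing`).

**The limit process** is built by placing, independently in each spherical shell
`k ≤ dist x x₀ < k + 1`, a Poisson number of independent points with the normalized intensity of
the shell (`exists_characteristic_functional`). Its counts are independent and Poisson because
their joint characteristic function factorizes.
-/

/-! ### Weak convergence from characteristic functions of countably many coordinates -/

/-- If the topology of `E` is induced by a sequence of real functions `Φ k`, then convergence of
all characteristic functions of finite subfamilies of the `Φ k` implies weak convergence. No
tightness has to be checked: an open set is an increasing union of sets that depend on finitely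
many coordinates, and Lévy's theorem gives the portmanteau inequality for each of those. -/
theorem tendsto_probabilityMeasure_of_isInducing {E : Type*} [TopologicalSpace E]
    [MeasurableSpace E] [BorelSpace E] {Φ : E → ℕ → ℝ} (hΦ : IsInducing Φ)
    {μs : ℕ → ProbabilityMeasure E} {μ : ProbabilityMeasure E}
    (h : ∀ (K : ℕ) (t : Fin K → ℝ),
      Tendsto (fun n => ∫ x, Complex.exp ((∑ i : Fin K, Φ x i * t i : ℝ) * Complex.I)
        ∂(μs n : Measure E)) atTop
        (𝓝 (∫ x, Complex.exp ((∑ i : Fin K, Φ x i * t i : ℝ) * Complex.I) ∂(μ : Measure E)))) :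
    Tendsto μs atTop (𝓝 μ) := by
  refine tendsto_of_forall_isOpen_le_liminf_nat' fun G hG => ?_
  obtain ⟨U, hU, rfl⟩ := hΦ.isOpen_iff.1 hG
  let π : ∀ K : ℕ, (ℕ → ℝ) → EuclideanSpace ℝ (Fin K) := fun K y => WithLp.toLp 2 fun i => y i
  have hπ : ∀ K, Continuous (π K) := fun K => by fun_prop
  have hπΦ : ∀ K, Continuous fun x => π K (Φ x) := fun K => (hπ K).comp hΦ.continuous
  -- the largest open set of the first `K` coordinates whose cylinder lies in `U`
  let O : ∀ K : ℕ, Set (EuclideanSpace ℝ (Fin K)) := fun K =>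
    ⋃₀ {V | IsOpen V ∧ π K ⁻¹' V ⊆ U}
  have hO : ∀ K, IsOpen (O K) := fun K => isOpen_sUnion fun V hV => hV.1
  have hOU : ∀ K, π K ⁻¹' (O K) ⊆ U := by
    rintro K y ⟨V, hV, hy⟩
    exact hV.2 hy
  have hmono : Monotone fun K => Φ ⁻¹' (π K ⁻¹' (O K)) := by
    rintro K L hKL x ⟨V, hV, hx⟩
    let r : EuclideanSpace ℝ (Fin L) → EuclideanSpace ℝ (Fin K) :=
      fun y => WithLp.toLp 2 fun i => y (Fin.castLE hKL i)
    have hr : Continuous r := by fun_prop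
    exact ⟨r ⁻¹' V, ⟨hV.1.preimage hr, hV.2⟩, hx⟩
  have hunion : Φ ⁻¹' U = ⋃ K, Φ ⁻¹' (π K ⁻¹' (O K)) := by
    refine subset_antisymm (fun x hx => ?_) (Set.iUnion_subset fun K => Set.preimage_mono (hOU K))
    obtain ⟨I, u, hu, hIU⟩ := isOpen_pi_iff.1 hU (Φ x) hx
    obtain ⟨K, hK⟩ := I.exists_nat_subset_range
    refine Set.mem_iUnion.2 ⟨K, {y | ∀ i : Fin K, (i : ℕ) ∈ I → y i ∈ u i}, ⟨?_, ?_⟩, ?_⟩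
    · simp only [Set.ofPred_forall]
      refine isOpen_iInter_of_finite fun i => isOpen_iInter_of_finite fun hi => ?_
      exact (hu i hi).1.preimage (by fun_prop)
    · exact fun y hy => hIU fun i hi => hy ⟨i, Finset.mem_range.1 (hK hi)⟩ hi
    · exact fun i hi => (hu i hi).2
  rw [hunion, hmono.measure_iUnion]
  refine iSup_le fun K => ?_
  have hK : Tendsto (fun n => (μs n).map (hπΦ K).measurable.aemeasurable) atTop
      (𝓝 (μ.map (hπΦ K).measurable.aemeasurable)) := by
    refine ProbabilityMeasure.tendsto_of_tendsto_charFun fun t => ?_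
    have key : ∀ ρ : ProbabilityMeasure E,
        charFun (ρ.map (hπΦ K).measurable.aemeasurable : Measure (EuclideanSpace ℝ (Fin K))) t =
          ∫ x, Complex.exp ((∑ i : Fin K, Φ x i * t i : ℝ) * Complex.I) ∂(ρ : Measure E) := by
      intro ρ
      rw [charFun_apply, ProbabilityMeasure.toMeasure_map,
        integral_map (hπΦ K).measurable.aemeasurable (by fun_prop)]
      refine integral_congr_ae (Eventually.of_forall fun x => ?_)
      simp [π, PiLp.inner_apply, mul_comm]
    simp_rw [key]
    exact h K t
  have hlim := ProbabilityMeasure.le_liminf_measure_open_of_tendsto hK (hO K)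
  simp only [ProbabilityMeasure.toMeasure_map,
    Measure.map_apply (hπΦ K).measurable (hO K).measurableSet] at hlim
  refine hlim.trans (liminf_le_liminf (Eventually.of_forall fun n => ?_))
  exact measure_mono (Set.subset_iUnion (fun K => Φ ⁻¹' (π K ⁻¹' (O K))) K)

/-! ### The vague topology -/

namespace LocallyFiniteMeasure

section Topological

variable {X : Type*} [TopologicalSpace X] [MeasurableSpace X]

instance (μ : LocallyFiniteMeasure X) : IsLocallyFiniteMeasure μ.toMeasure := μ.2

theorem continuous_integral (f : C_c(X, ℝ)) :
    Continuous fun μ : LocallyFiniteMeasure X => ∫ x, f x ∂μ.toMeasure :=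
  continuous_iff_le_induced.2 (iInf_le _ f)

theorem integrable [OpensMeasurableSpace X] (f : C_c(X, ℝ)) (μ : LocallyFiniteMeasure X) :
    Integrable (fun x => f x) μ.toMeasure :=
  f.continuous.integrable_of_hasCompactSupport f.hasCompactSupport

end Topological

variable {X : Type*} [MetricSpace X] [ProperSpace X] [MeasurableSpace X] [BorelSpace X]

/-- A countable family of test functions that approximates every test function `f` uniformly,
relative to a member `h` of the family which may depend on `f` but not on the accuracy. -/
theorem exists_countable_dense (X : Type*) [MetricSpace X] [ProperSpace X] :
    ∃ F : ℕ → C_c(X, ℝ), ∀ f : C_c(X, ℝ), ∃ k, ∀ ε > 0, ∃ j, ∀ x, |f x - F j x| ≤ ε * F k x := by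
  cases isEmpty_or_nonempty X with
  | inl _ => exact ⟨fun _ => 0, fun f => ⟨0, fun ε _ => ⟨0, fun x => isEmptyElim x⟩⟩⟩
  | inr hne =>
  obtain ⟨x₀⟩ := hne
  -- cut-off functions
  let b : ℕ → C_c(X, ℝ) := fun m =>
    { toFun := fun x => max 0 (min 1 (m + 1 - dist x x₀))
      continuous_toFun := by fun_prop
      hasCompactSupport' := by
        refine HasCompactSupport.intro (isCompact_closedBall x₀ (m + 1)) fun x hx => ?_
        rw [Metric.mem_closedBall, not_le] at hx
        exact max_eq_left ((min_le_right _ _).trans (by linarith)) }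
  have hb : ∀ m x, b m x = max 0 (min 1 (m + 1 - dist x x₀)) := fun m x => rfl
  have hb0 : ∀ m x, 0 ≤ b m x := fun m x => le_max_left _ _
  obtain ⟨d, hd⟩ := TopologicalSpace.exists_dense_seq C(X, ℝ)
  let bd : ℕ → ℕ → C_c(X, ℝ) := fun m j =>
    { toFun := fun x => b m x * d j x
      continuous_toFun := (b m).continuous.mul (d j).continuous
      hasCompactSupport' := (b m).hasCompactSupport.mul_right }
  let F : Option ℕ × ℕ → C_c(X, ℝ) := fun p => p.1.elim (b p.2) fun j => bd p.2 j
  obtain ⟨e, he⟩ := exists_surjective_nat (Option ℕ × ℕ)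
  refine ⟨fun k => F (e k), fun f => ?_⟩
  obtain ⟨m, hm⟩ : ∃ m : ℕ, tsupport f ⊆ Metric.closedBall x₀ m := by
    obtain ⟨r, hr⟩ := f.hasCompactSupport.isCompact.isBounded.subset_closedBall x₀
    obtain ⟨m, hm⟩ := exists_nat_ge r
    exact ⟨m, hr.trans (Metric.closedBall_subset_closedBall hm)⟩
  obtain ⟨k, hk⟩ := he (none, m)
  refine ⟨k, fun ε hε => ?_⟩
  have hopen : {g : C(X, ℝ) | ∀ x ∈ Metric.closedBall x₀ (m + 1), dist (f x) (g x) < ε} ∈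
      𝓝 (f : C(X, ℝ)) := by
    have := (ContinuousMap.tendsto_iff_forall_isCompact_tendstoUniformlyOn
      (F := id) (p := 𝓝 (f : C(X, ℝ)))).1 tendsto_id _ (isCompact_closedBall x₀ (m + 1 : ℝ))
    exact (Metric.tendstoUniformlyOn_iff.1 this) ε hε
  obtain ⟨g, ⟨j, rfl⟩, hg⟩ := hd.inter_nhds_nonempty hopen
  obtain ⟨l, hl⟩ := he (some j, m)
  refine ⟨l, fun x => ?_⟩
  simp only [hk, hl, F, Option.elim]
  change |f x - b m x * d j x| ≤ ε * b m x
  have hfb : f x = b m x * f x := by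
    by_cases hx : x ∈ tsupport f
    · have := hm hx
      rw [Metric.mem_closedBall] at this
      rw [hb, min_eq_left (by linarith), max_eq_right zero_le_one, one_mul]
    · rw [image_eq_zero_of_notMem_tsupport hx, mul_zero]
  rw [hfb, ← mul_sub, abs_mul, abs_of_nonneg (hb0 m x), mul_comm ε]
  by_cases hx : x ∈ Metric.closedBall x₀ (m + 1 : ℝ)
  · exact mul_le_mul_of_nonneg_left (hg x hx).le (hb0 m x)
  · rw [Metric.mem_closedBall, not_le] at hx
    have : b m x = 0 := max_eq_left ((min_le_right _ _).trans (by linarith))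
    simp [this]

/-- On a proper metric space the vague topology is induced by countably many test functions. -/
theorem exists_isInducing (X : Type*) [MetricSpace X] [ProperSpace X] [MeasurableSpace X]
    [BorelSpace X] : ∃ F : ℕ → C_c(X, ℝ),
      IsInducing fun (μ : LocallyFiniteMeasure X) (k : ℕ) => ∫ x, F k x ∂μ.toMeasure := by
  obtain ⟨F, hF⟩ := exists_countable_dense X
  refine ⟨F, ⟨le_antisymm (continuous_iff_le_induced.1
    (continuous_pi fun k => continuous_integral (F k))) (le_iInf fun f => ?_)⟩⟩
  rw [← continuous_iff_le_induced]
  let τ : TopologicalSpace (LocallyFiniteMeasure X) :=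
    TopologicalSpace.induced (fun μ k => ∫ x, F k x ∂μ.toMeasure) inferInstance
  have hFc : ∀ k, Continuous[τ, _] fun μ : LocallyFiniteMeasure X => ∫ x, F k x ∂μ.toMeasure :=
    fun k => @Continuous.comp _ _ _ τ _ _ _ (fun y : ℕ → ℝ => y k) (continuous_apply k)
      continuous_induced_dom
  obtain ⟨k, hk⟩ := hF f
  refine @continuous_of_locally_uniform_approx_of_continuousAt _ _ τ _ _ fun μ₀ u hu => ?_
  obtain ⟨ε, hε, hεu⟩ := Metric.mem_uniformity_dist.1 hu
  set M : ℝ := |∫ x, F k x ∂μ₀.toMeasure| + 1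
  have hM : 0 < M := by positivity
  obtain ⟨j, hj⟩ := hk (ε / (2 * M)) (by positivity)
  refine ⟨{μ | ∫ x, F k x ∂μ.toMeasure < M}, ?_, fun μ => ∫ x, F j x ∂μ.toMeasure,
    (hFc j).continuousAt, fun μ hμ => hεu ?_⟩
  · refine (hFc k).continuousAt.eventually_lt continuousAt_const ?_
    linarith [le_abs_self (∫ x, F k x ∂μ₀.toMeasure)]
  · rw [Real.dist_eq, ← integral_sub (integrable f μ) (integrable (F j) μ)]
    calc |∫ x, f x - F j x ∂μ.toMeasure| ≤ ∫ x, |f x - F j x| ∂μ.toMeasure :=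
          abs_integral_le_integral_abs
      _ ≤ ∫ x, ε / (2 * M) * F k x ∂μ.toMeasure :=
          integral_mono ((integrable f μ).sub (integrable (F j) μ)).abs
            ((integrable (F k) μ).const_mul _) hj
      _ = ε / (2 * M) * ∫ x, F k x ∂μ.toMeasure := integral_const_mul _ _
      _ ≤ ε / (2 * M) * M := mul_le_mul_of_nonneg_left (le_of_lt hμ) (by positivity)
      _ < ε := by field_simp; norm_num

theorem measurable_of_integral {Ω : Type*} [MeasurableSpace Ω] {χ : Ω → LocallyFiniteMeasure X}
    (h : ∀ f : C_c(X, ℝ), Measurable fun ω => ∫ x, f x ∂(χ ω).toMeasure) : Measurable χ := by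
  obtain ⟨F, hF⟩ := exists_isInducing X
  have hborel : (borel (LocallyFiniteMeasure X)) =
      MeasurableSpace.comap (fun μ k => ∫ x, F k x ∂μ.toMeasure) inferInstance := by
    rw [hF.eq_induced, borel_comap]
    exact congrArg _ (BorelSpace.measurable_eq (α := ℕ → ℝ)).symm
  have hle : Measurable[_, borel (LocallyFiniteMeasure X)] χ := by
    rw [hborel, measurable_comap_iff]
    exact measurable_pi_lambda _ fun k => h (F k)
  exact hle

/-- Convergence in distribution of random measures follows from the convergence of their
characteristic functionals on test functions. -/
theorem tendstoInDistribution_of_tendsto_charFun {Ω : ℕ → Type*} [∀ n, MeasurableSpace (Ω n)]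
    {P : ∀ n, Measure (Ω n)} [∀ n, IsProbabilityMeasure (P n)] {Ω' : Type*} [MeasurableSpace Ω']
    {P' : Measure Ω'} [IsProbabilityMeasure P'] {ξ : ∀ n, Ω n → LocallyFiniteMeasure X}
    {χ : Ω' → LocallyFiniteMeasure X} (hξ : ∀ n, AEMeasurable (ξ n) (P n))
    (hχ : AEMeasurable χ P')
    (h : ∀ f : C_c(X, ℝ), Tendsto
      (fun n => ∫ ω, Complex.exp ((∫ x, f x ∂(ξ n ω).toMeasure : ℝ) * Complex.I) ∂P n) atTop
      (𝓝 (∫ ω, Complex.exp ((∫ x, f x ∂(χ ω).toMeasure : ℝ) * Complex.I) ∂P'))) :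
    TendstoInDistribution ξ atTop χ P P' := by
  refine ⟨hξ, hχ, ?_⟩
  obtain ⟨F, hF⟩ := exists_isInducing X
  refine tendsto_probabilityMeasure_of_isInducing hF fun K t => ?_
  have key : ∀ μ : LocallyFiniteMeasure X, ∑ i : Fin K, (∫ x, F i x ∂μ.toMeasure) * t i =
      ∫ x, (∑ i : Fin K, t i • F i : C_c(X, ℝ)) x ∂μ.toMeasure := by
    intro μ
    simp_rw [CompactlySupportedContinuousMap.sum_apply,
      CompactlySupportedContinuousMap.smul_apply, smul_eq_mul]
    rw [integral_finsetSum _ fun (i : Fin K) _ => (integrable (F i) μ).const_mul (t i)]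
    simp_rw [integral_const_mul, mul_comm]
  simp_rw [key]
  have hm : Continuous fun μ : LocallyFiniteMeasure X => Complex.exp
      ((∫ x, (∑ i : Fin K, t i • F i : C_c(X, ℝ)) x ∂μ.toMeasure : ℝ) * Complex.I) := by
    have := continuous_integral (∑ i : Fin K, t i • F i : C_c(X, ℝ))
    fun_prop
  simp only [ProbabilityMeasure.coe_mk]
  rw [integral_map hχ hm.measurable.aestronglyMeasurable]
  simp_rw [fun n => integral_map (hξ n) hm.measurable.aestronglyMeasurable]
  exact h _

end LocallyFiniteMeasure

/-! ### Integrals over product and Poisson measures -/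

theorem integral_infinitePi_finset_prod {ι : Type*} {E : ι → Type*} [∀ i, MeasurableSpace (E i)]
    (μ : ∀ i, Measure (E i)) [∀ i, IsProbabilityMeasure (μ i)] (s : Finset ι)
    {g : ∀ i, E i → ℂ} (hg : ∀ i, Measurable (g i)) :
    ∫ x, ∏ i ∈ s, g i (x i) ∂Measure.infinitePi μ = ∏ i ∈ s, ∫ y, g i y ∂μ i := by
  have hm : Measurable fun y : (∀ i : s, E i) => ∏ i : s, g i (y i) :=
    Finset.measurable_prod _ fun i _ => (hg i).comp (measurable_pi_apply i)
  have h := integral_restrict_infinitePi μ (s := s) hm.aestronglyMeasurable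
  rw [integral_fintype_prod_eq_prod] at h
  rw [← Finset.prod_coe_sort s fun i => ∫ y, g i y ∂μ i, ← h]
  refine integral_congr_ae (Eventually.of_forall fun x => ?_)
  exact (Finset.prod_coe_sort s fun i => g i (x i)).symm

theorem lintegral_cast_poissonMeasure (r : ℝ≥0) : ∫⁻ n, (n : ℝ≥0∞) ∂poissonMeasure r = r := by
  rw [poissonMeasure, lintegral_sum_measure]
  simp_rw [lintegral_smul_measure, lintegral_dirac, smul_eq_mul]
  rw [tsum_eq_zero_add' ENNReal.summable]
  simp only [Nat.cast_zero, mul_zero, zero_add]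
  have h : ∀ n : ℕ, ENNReal.ofReal (Real.exp (-r) * r ^ (n + 1) / (n + 1).factorial) *
      ((n + 1 : ℕ) : ℝ≥0∞) = r * ENNReal.ofReal (Real.exp (-r) * r ^ n / n.factorial) := by
    intro n
    rw [← ENNReal.ofReal_natCast, ← ENNReal.ofReal_mul (by positivity), ← ENNReal.ofReal_coe_nnreal,
      ← ENNReal.ofReal_mul (by positivity), Nat.factorial_succ]
    congr 1
    push_cast
    field_simp
    ring
  simp_rw [h, ENNReal.tsum_mul_left]
  have h1 := hasSum_one_poissonMeasure r
  rw [← ENNReal.ofReal_tsum_of_nonneg (fun n => by positivity) h1.summable, h1.tsum_eq]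
  simp

section Piece

variable {X : Type*} [MeasurableSpace X]

theorem measurable_sum_range {M : Type*} [AddCommMonoid M] [MeasurableSpace M] [MeasurableAdd₂ M]
    {g : X → M} (hg : Measurable g) :
    Measurable fun p : ℕ × (ℕ → X) => ∑ j ∈ Finset.range p.1, g (p.2 j) :=
  measurable_from_prod_countable_right fun n =>
    Finset.measurable_sum (Finset.range n) fun j _ => hg.comp (measurable_pi_apply j)

/-- The law of a Poisson number of points and of an independent sequence of points. -/
noncomputable def poissonSequence (r : ℝ≥0) (ν : Measure X) : Measure (ℕ × (ℕ → X)) :=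
  (poissonMeasure r).prod (Measure.infinitePi fun _ : ℕ => ν)

instance (r : ℝ≥0) (ν : Measure X) [IsProbabilityMeasure ν] :
    IsProbabilityMeasure (poissonSequence r ν) := by
  unfold poissonSequence
  infer_instance

theorem lintegral_poissonSequence (r : ℝ≥0) (ν : Measure X) [IsProbabilityMeasure ν]
    {g : X → ℝ≥0∞} (hg : Measurable g) :
    ∫⁻ p, ∑ j ∈ Finset.range p.1, g (p.2 j) ∂poissonSequence r ν = r * ∫⁻ x, g x ∂ν := by
  rw [poissonSequence, lintegral_prod _ (measurable_sum_range hg).aemeasurable]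
  have h : ∀ n : ℕ, ∫⁻ x : ℕ → X, ∑ j ∈ Finset.range n, g (x j)
      ∂Measure.infinitePi (fun _ : ℕ => ν) = n * ∫⁻ x, g x ∂ν := by
    intro n
    rw [lintegral_finsetSum (Finset.range n) (f := fun j (x : ℕ → X) => g (x j))
      fun j _ => hg.comp (measurable_pi_apply j)]
    have : ∀ j : ℕ, ∫⁻ x : ℕ → X, g (x j) ∂Measure.infinitePi (fun _ : ℕ => ν) = ∫⁻ x, g x ∂ν :=
      fun j => (measurePreserving_eval_infinitePi (fun _ : ℕ => ν) j).lintegral_comp hg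
    simp [this]
  simp_rw [h]
  rw [lintegral_mul_const _ (by fun_prop), lintegral_cast_poissonMeasure]

/-- The generating functional of a Poisson number of independent points. -/
theorem integral_poissonSequence (r : ℝ≥0) (ν : Measure X) [IsProbabilityMeasure ν]
    {g : X → ℂ} (hg : Measurable g) (hg1 : ∀ x, ‖g x‖ ≤ 1) :
    ∫ p, ∏ j ∈ Finset.range p.1, g (p.2 j) ∂poissonSequence r ν =
      Complex.exp (r * (∫ x, g x ∂ν - 1)) := by
  have hm : Measurable fun p : ℕ × (ℕ → X) => ∏ j ∈ Finset.range p.1, g (p.2 j) :=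
    measurable_from_prod_countable_right fun n =>
      Finset.measurable_prod (Finset.range n) fun j _ => hg.comp (measurable_pi_apply j)
  have hint : Integrable (fun p : ℕ × (ℕ → X) => ∏ j ∈ Finset.range p.1, g (p.2 j))
      (poissonSequence r ν) := by
    refine Integrable.of_bound hm.aestronglyMeasurable 1 (Eventually.of_forall fun p => ?_)
    rw [norm_prod]
    exact Finset.prod_le_one (fun _ _ => norm_nonneg _) fun _ _ => hg1 _
  rw [poissonSequence, integral_prod _ hint]
  simp_rw [integral_infinitePi_finset_prod (fun _ : ℕ => ν) (Finset.range _) fun _ => hg,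
    Finset.prod_const, Finset.card_range]
  rw [integral_poissonMeasure]
  have h := (NormedSpace.expSeries_div_hasSum_exp ((r : ℂ) * ∫ x, g x ∂ν)).mul_left
    (Complex.exp (-r))
  rw [← Complex.exp_eq_exp_ℂ, ← Complex.exp_add] at h
  rw [show (r : ℂ) * (∫ x, g x ∂ν - 1) = -r + r * ∫ x, g x ∂ν by ring, ← h.tsum_eq]
  refine tsum_congr fun n => ?_
  rw [Complex.real_smul]
  push_cast
  ring

end Piece

theorem exists_isProbabilityMeasure_smul_eq {X : Type*} [MeasurableSpace X] [Nonempty X]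
    (μ : Measure X) [IsFiniteMeasure μ] :
    ∃ ν : Measure X, IsProbabilityMeasure ν ∧ (μ Set.univ).toNNReal • ν = μ := by
  by_cases h : μ = 0
  · obtain ⟨x⟩ := ‹Nonempty X›
    exact ⟨Measure.dirac x, inferInstance, by simp [h]⟩
  · have : NeZero μ := ⟨h⟩
    refine ⟨(μ Set.univ)⁻¹ • μ, inferInstance, ?_⟩
    have h0 : μ Set.univ ≠ 0 := by simpa using h
    ext B hB
    rw [Measure.smul_apply, Measure.smul_apply, ENNReal.smul_def,
      ENNReal.coe_toNNReal (measure_ne_top _ _), smul_eq_mul, smul_eq_mul, ← mul_assoc,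
      ENNReal.mul_inv_cancel h0 (measure_ne_top _ _), one_mul]

/-! ### Construction of a Poisson point process -/

section Construction

variable {X : Type*} [MetricSpace X]

/-- The spherical shell of the points whose distance to `x₀` has integer part `k`. -/
def shell (x₀ : X) (k : ℕ) : Set X := {x | ⌊dist x x₀⌋₊ = k}

theorem shell_subset_ball (x₀ : X) {k K : ℕ} (h : k < K) : shell x₀ k ⊆ Metric.ball x₀ K := by
  rintro x rfl
  exact (Nat.floor_lt dist_nonneg).1 h

theorem disjoint_shell_ball (x₀ : X) {k K : ℕ} (h : K ≤ k) :
    Disjoint (shell x₀ k) (Metric.ball x₀ K) := by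
  rw [Set.disjoint_left]
  rintro x rfl hx
  exact absurd ((Nat.floor_lt dist_nonneg).2 hx) (not_lt.2 h)

theorem iUnion_shell (x₀ : X) : ⋃ k, shell x₀ k = Set.univ :=
  Set.eq_univ_of_forall fun x => Set.mem_iUnion.2 ⟨⌊dist x x₀⌋₊, rfl⟩

theorem pairwise_disjoint_shell (x₀ : X) : Pairwise fun k l => Disjoint (shell x₀ k) (shell x₀ l) :=
  fun _ _ hkl => Set.disjoint_left.2 fun _ hk hl => hkl (hk.symm.trans hl)

variable [MeasurableSpace X]

/-- The sum of the point masses at the first `(ω k).1` terms of the sequence `(ω k).2`, over all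
`k`, where only the points in the `k`-th shell are kept. -/
noncomputable def shellSample (x₀ : X) (ω : ℕ → ℕ × (ℕ → X)) : Measure X :=
  Measure.sum fun k => ∑ j ∈ Finset.range (ω k).1, (Measure.dirac ((ω k).2 j)).restrict (shell x₀ k)

variable [BorelSpace X]

theorem measurableSet_shell (x₀ : X) (k : ℕ) : MeasurableSet (shell x₀ k) :=
  (Nat.measurable_floor.comp (continuous_id.dist continuous_const).measurable)
    (measurableSet_singleton k)

theorem lintegral_shellSample (x₀ : X) (ω : ℕ → ℕ × (ℕ → X)) {g : X → ℝ≥0∞} (hg : Measurable g) :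
    ∫⁻ x, g x ∂shellSample x₀ ω =
      ∑' k, ∑ j ∈ Finset.range (ω k).1, (shell x₀ k).indicator g ((ω k).2 j) := by
  simp_rw [shellSample, lintegral_sum_measure, lintegral_finsetSum_measure,
    ← lintegral_indicator (measurableSet_shell x₀ _),
    lintegral_dirac' _ (hg.indicator (measurableSet_shell x₀ _))]

theorem shellSample_restrict_ball (x₀ : X) (ω : ℕ → ℕ × (ℕ → X)) (K : ℕ) :
    (shellSample x₀ ω).restrict (Metric.ball x₀ K) = ∑ k ∈ Finset.range K,
      ∑ j ∈ Finset.range (ω k).1, (Measure.dirac ((ω k).2 j)).restrict (shell x₀ k) := by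
  ext B hB
  have hb : MeasurableSet (Metric.ball x₀ (K : ℝ)) := Metric.isOpen_ball.measurableSet
  simp_rw [Measure.restrict_apply hB, shellSample, Measure.sum_apply _ (hB.inter hb),
    Measure.finsetSum_apply, Measure.restrict_apply (hB.inter hb), Measure.restrict_apply hB]
  rw [tsum_eq_sum (s := Finset.range K)]
  · refine Finset.sum_congr rfl fun k hk => Finset.sum_congr rfl fun j _ => ?_
    rw [Set.inter_assoc,
      Set.inter_eq_right.2 (shell_subset_ball x₀ (Finset.mem_range.1 hk))]
  · intro k hk
    refine Finset.sum_eq_zero fun j _ => ?_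
    rw [Set.inter_assoc, Set.inter_comm (Metric.ball _ _),
      (disjoint_shell_ball x₀ (by simpa using hk)).inter_eq, Set.inter_empty, measure_empty]

/-- Each ball meets only finitely many shells, so no exceptional null set has to be removed. -/
instance (x₀ : X) (ω : ℕ → ℕ × (ℕ → X)) : IsLocallyFiniteMeasure (shellSample x₀ ω) := by
  refine ⟨fun x => ?_⟩
  obtain ⟨K, hK⟩ := exists_nat_gt (dist x x₀)
  refine ⟨Metric.ball x₀ K, Metric.isOpen_ball.mem_nhds hK, ?_⟩
  rw [← Measure.restrict_apply_univ, shellSample_restrict_ball]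
  simp_rw [Measure.finsetSum_apply]
  exact ENNReal.sum_lt_top.2 fun k _ => ENNReal.sum_lt_top.2 fun j _ => measure_lt_top _ _

theorem integral_shellSample (x₀ : X) (ω : ℕ → ℕ × (ℕ → X)) {f : X → ℝ} (hf : Measurable f)
    {K : ℕ} (hK : ∀ x ∉ Metric.ball x₀ (K : ℝ), f x = 0) :
    ∫ x, f x ∂shellSample x₀ ω = ∑ k ∈ Finset.range K,
      ∑ j ∈ Finset.range (ω k).1, (shell x₀ k).indicator f ((ω k).2 j) := by
  have hint : ∀ k j, Integrable f ((Measure.dirac ((ω k).2 j)).restrict (shell x₀ k)) :=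
    fun k j => ((integrable_dirac' hf.stronglyMeasurable (by simp)).mono_measure
      Measure.restrict_le_self)
  rw [← setIntegral_eq_integral_of_forall_compl_eq_zero hK, shellSample_restrict_ball,
    integral_finsetSum_measure fun k _ => integrable_finsetSum_measure.2 fun j _ => hint k j]
  refine Finset.sum_congr rfl fun k _ => ?_
  rw [integral_finsetSum_measure fun j _ => hint k j]
  refine Finset.sum_congr rfl fun j _ => ?_
  rw [← integral_indicator (measurableSet_shell x₀ k),
    integral_dirac' _ _ (hf.indicator (measurableSet_shell x₀ k)).stronglyMeasurable]

theorem measurable_lintegral_shellSample (x₀ : X) {g : X → ℝ≥0∞} (hg : Measurable g) :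
    Measurable fun ω : ℕ → ℕ × (ℕ → X) => ∫⁻ x, g x ∂shellSample x₀ ω := by
  simp_rw [lintegral_shellSample x₀ _ hg]
  exact Measurable.tsum fun k =>
    (measurable_sum_range (hg.indicator (measurableSet_shell x₀ k))).comp (measurable_pi_apply k)

/-- For every `k`, a probability measure `ν k` with a multiple equal to the restriction of `Λ` to
the `k`-th shell. -/
theorem exists_shell_law [ProperSpace X] (x₀ : X) (Λ : Measure X) [IsLocallyFiniteMeasure Λ] :
    ∃ ν : ℕ → Measure X, (∀ k, IsProbabilityMeasure (ν k)) ∧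
      ∀ k, (Λ (shell x₀ k)).toNNReal • ν k = Λ.restrict (shell x₀ k) := by
  have : Nonempty X := ⟨x₀⟩
  have hfin : ∀ k, IsFiniteMeasure (Λ.restrict (shell x₀ k)) := fun k => ⟨by
    rw [Measure.restrict_apply_univ]
    exact (measure_mono (shell_subset_ball x₀ (Nat.lt_succ_self k))).trans_lt
      Metric.isBounded_ball.measure_lt_top⟩
  choose ν hν1 hν2 using fun k => exists_isProbabilityMeasure_smul_eq (Λ.restrict (shell x₀ k))
  exact ⟨ν, hν1, fun k => by simpa using hν2 k⟩

section Law

variable (x₀ : X) (Λ : Measure X) (ν : ℕ → Measure X) [∀ k, IsProbabilityMeasure (ν k)]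

/-- The law of independent Poisson samples in the shells. -/
noncomputable def shellLaw : Measure (ℕ → ℕ × (ℕ → X)) :=
  Measure.infinitePi fun k => poissonSequence (Λ (shell x₀ k)).toNNReal (ν k)

instance : IsProbabilityMeasure (shellLaw x₀ Λ ν) := by
  unfold shellLaw
  infer_instance

variable {Λ ν}

/-- Campbell's formula for the sampled measure. -/
theorem lintegral_lintegral_shellSample
    (hν : ∀ k, (Λ (shell x₀ k)).toNNReal • ν k = Λ.restrict (shell x₀ k)) {g : X → ℝ≥0∞}
    (hg : Measurable g) :
    ∫⁻ ω, ∫⁻ x, g x ∂shellSample x₀ ω ∂shellLaw x₀ Λ ν = ∫⁻ x, g x ∂Λ := by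
  have hS := measurableSet_shell x₀
  have hm := fun k => measurable_sum_range (hg.indicator (hS k))
  simp_rw [lintegral_shellSample x₀ _ hg]
  rw [lintegral_tsum (f := fun k (ω : ℕ → ℕ × (ℕ → X)) =>
      ∑ j ∈ Finset.range (ω k).1, (shell x₀ k).indicator g ((ω k).2 j))
    fun k => ((hm k).comp (measurable_pi_apply k)).aemeasurable,
    ← setLIntegral_univ, ← iUnion_shell x₀, lintegral_iUnion hS (pairwise_disjoint_shell x₀)]
  refine tsum_congr fun k => ?_
  have h1 := (measurePreserving_eval_infinitePi
    (fun k => poissonSequence (Λ (shell x₀ k)).toNNReal (ν k)) k).lintegral_comp (hm k)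
  refine h1.trans ?_
  rw [lintegral_poissonSequence _ _ (hg.indicator (hS k)),
    setLIntegral_congr_fun (g := (shell x₀ k).indicator g) (hS k)
      fun x hx => (Set.indicator_of_mem hx g).symm, ← hν k, lintegral_smul_measure]
  rfl

/-- The characteristic functional of the sampled measure, on functions with bounded support. -/
theorem integral_exp_integral_shellSample_of_bounded
    (hν : ∀ k, (Λ (shell x₀ k)).toNNReal • ν k = Λ.restrict (shell x₀ k)) {f : X → ℝ}
    (hf : Measurable f) (hfΛ : Integrable f Λ) {K : ℕ}
    (hK : ∀ x ∉ Metric.ball x₀ (K : ℝ), f x = 0) :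
    ∫ ω, Complex.exp ((∫ x, f x ∂shellSample x₀ ω : ℝ) * Complex.I) ∂shellLaw x₀ Λ ν =
      Complex.exp (∫ x, (Complex.exp (f x * Complex.I) - 1) ∂Λ) := by
  have hS := measurableSet_shell x₀
  let g : ℕ → X → ℂ := fun k x => Complex.exp (((shell x₀ k).indicator f x : ℝ) * Complex.I)
  have hg : ∀ k, Measurable (g k) := fun k => by
    have := hf.indicator (hS k)
    fun_prop
  have hgp : ∀ k, Measurable fun p : ℕ × (ℕ → X) => ∏ j ∈ Finset.range p.1, g k (p.2 j) :=
    fun k => measurable_from_prod_countable_right fun n =>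
      Finset.measurable_prod (Finset.range n) fun j _ => (hg k).comp (measurable_pi_apply j)
  have h1 : ∀ ω : ℕ → ℕ × (ℕ → X),
      Complex.exp ((∫ x, f x ∂shellSample x₀ ω : ℝ) * Complex.I) =
        ∏ k ∈ Finset.range K, ∏ j ∈ Finset.range (ω k).1, g k ((ω k).2 j) := by
    intro ω
    simp_rw [g, ← Complex.exp_sum, ← Finset.sum_mul, integral_shellSample x₀ ω hf hK]
    push_cast
    rfl
  simp_rw [h1]
  rw [shellLaw, integral_infinitePi_finset_prod _ (Finset.range K) hgp]
  have hexp : Integrable (fun x => Complex.exp (f x * Complex.I) - 1) Λ := by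
    refine hfΛ.norm.mono' (by fun_prop) (Eventually.of_forall fun x => ?_)
    rw [mul_comm]
    exact Real.norm_exp_I_mul_ofReal_sub_one_le
  have h2 : ∀ k, ∫ p, ∏ j ∈ Finset.range p.1, g k (p.2 j)
      ∂poissonSequence (Λ (shell x₀ k)).toNNReal (ν k) =
      Complex.exp (∫ x in shell x₀ k, (Complex.exp (f x * Complex.I) - 1) ∂Λ) := by
    intro k
    rw [integral_poissonSequence _ _ (hg k) fun x => (Complex.norm_exp_ofReal_mul_I _).le]
    have hgint : Integrable (g k) (ν k) := Integrable.of_bound (hg k).aestronglyMeasurable 1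
      (Eventually.of_forall fun x => (Complex.norm_exp_ofReal_mul_I _).le)
    rw [setIntegral_congr_fun (g := fun x => g k x - 1) (hS k)
      fun x hx => by simp only [g, Set.indicator_of_mem hx], ← hν k, integral_smul_nnreal_measure,
      integral_sub hgint (integrable_const _), integral_const, probReal_univ, one_smul]
    rfl
  have hball : Metric.ball x₀ (K : ℝ) = ⋃ k ∈ Finset.range K, shell x₀ k := by
    refine subset_antisymm (fun x hx => ?_) (Set.iUnion₂_subset fun k hk =>
      shell_subset_ball x₀ (Finset.mem_range.1 hk))
    exact Set.mem_biUnion (Finset.mem_coe.2 (Finset.mem_range.2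
      ((Nat.floor_lt dist_nonneg).2 hx))) rfl
  simp_rw [h2, ← Complex.exp_sum]
  rw [← setIntegral_eq_integral_of_forall_compl_eq_zero (s := Metric.ball x₀ (K : ℝ))
    fun x hx => by simp [hK x hx], hball, integral_biUnion_finset _ (fun k _ => hS k)
      (fun k _ l _ hkl => pairwise_disjoint_shell x₀ hkl) fun k _ => hexp.integrableOn]

/-- The characteristic functional of the sampled measure, on integrable functions, by exhaustion of
the space with balls. -/
theorem integral_exp_integral_shellSample
    (hν : ∀ k, (Λ (shell x₀ k)).toNNReal • ν k = Λ.restrict (shell x₀ k)) {f : X → ℝ}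
    (hf : Measurable f) (hfΛ : Integrable f Λ) :
    ∫ ω, Complex.exp ((∫ x, f x ∂shellSample x₀ ω : ℝ) * Complex.I) ∂shellLaw x₀ Λ ν =
      Complex.exp (∫ x, (Complex.exp (f x * Complex.I) - 1) ∂Λ) := by
  have hball : ∀ K : ℕ, MeasurableSet (Metric.ball x₀ (K : ℝ)) :=
    fun K => Metric.isOpen_ball.measurableSet
  let fK : ℕ → X → ℝ := fun K => (Metric.ball x₀ (K : ℝ)).indicator f
  have hfK : ∀ K, Measurable (fK K) := fun K => hf.indicator (hball K)
  have hlim : ∀ x, ∀ᶠ K in atTop, fK K x = f x := by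
    intro x
    obtain ⟨K, hK⟩ := exists_nat_gt (dist x x₀)
    filter_upwards [eventually_ge_atTop K] with L hL
    exact Set.indicator_of_mem (Metric.mem_ball.2 (hK.trans_le (Nat.cast_le.2 hL))) f
  have hle : ∀ K x, ‖fK K x‖ ≤ ‖f x‖ := fun K x => norm_indicator_le_norm_self f x
  have hfin : ∀ᵐ ω ∂shellLaw x₀ Λ ν, Integrable f (shellSample x₀ ω) := by
    have h := lintegral_lintegral_shellSample x₀ hν hf.enorm
    have h' := ae_lt_top (measurable_lintegral_shellSample x₀ hf.enorm)
      (h.trans_ne hfΛ.hasFiniteIntegral.ne)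
    filter_upwards [h'] with ω hω
    exact ⟨hf.aestronglyMeasurable, hω⟩
  have hL : Tendsto (fun K => ∫ ω, Complex.exp
      ((∫ x, fK K x ∂shellSample x₀ ω : ℝ) * Complex.I) ∂shellLaw x₀ Λ ν) atTop
      (𝓝 (∫ ω, Complex.exp ((∫ x, f x ∂shellSample x₀ ω : ℝ) * Complex.I)
        ∂shellLaw x₀ Λ ν)) := by
    refine tendsto_integral_of_dominated_convergence (fun _ => 1) (fun K => ?_)
      (integrable_const _) (fun K => Eventually.of_forall fun ω =>
        (Complex.norm_exp_ofReal_mul_I _).le) ?_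
    · have : Measurable fun ω => ∫ x, fK K x ∂shellSample x₀ ω := by
        simp_rw [integral_shellSample x₀ _ (hfK K) fun x hx => Set.indicator_of_notMem hx f]
        exact Finset.measurable_sum (Finset.range K) fun k _ =>
          (measurable_sum_range ((hfK K).indicator (measurableSet_shell x₀ k))).comp
            (measurable_pi_apply k)
      exact Measurable.aestronglyMeasurable (by fun_prop)
    · filter_upwards [hfin] with ω hω
      have := tendsto_integral_of_dominated_convergence (fun x => ‖f x‖)
        (fun K => (hfK K).aestronglyMeasurable) hω.norm
        (fun K => Eventually.of_forall (hle K))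
        (Eventually.of_forall fun x => tendsto_nhds_of_eventually_eq (hlim x))
      have hc : Continuous fun y : ℝ => Complex.exp (y * Complex.I) := by fun_prop
      exact (hc.tendsto _).comp this
  have hR : Tendsto (fun K => Complex.exp (∫ x, (Complex.exp (fK K x * Complex.I) - 1) ∂Λ)) atTop
      (𝓝 (Complex.exp (∫ x, (Complex.exp (f x * Complex.I) - 1) ∂Λ))) := by
    refine (Complex.continuous_exp.tendsto _).comp ?_
    refine tendsto_integral_of_dominated_convergence (fun x => ‖f x‖) (fun K => ?_) hfΛ.norm
      (fun K => Eventually.of_forall fun x => ?_) (Eventually.of_forall fun x =>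
        tendsto_nhds_of_eventually_eq ?_)
    · have := hfK K
      exact Measurable.aestronglyMeasurable (by fun_prop)
    · rw [mul_comm]
      exact Real.norm_exp_I_mul_ofReal_sub_one_le.trans (hle K x)
    · filter_upwards [hlim x] with K hK
      rw [hK]
  refine tendsto_nhds_unique hL ?_
  simp_rw [integral_exp_integral_shellSample_of_bounded x₀ hν (hfK _)
    (hfΛ.indicator (hball _)) fun x hx => Set.indicator_of_notMem hx f]
  exact hR

end Law

/-- A Poisson point process with a given locally finite intensity `Λ`, presented by Campbell's
formula and by its characteristic functional. -/
theorem exists_characteristic_functional {X : Type*} [MetricSpace X] [ProperSpace X]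
    [MeasurableSpace X] [BorelSpace X] [Nonempty X] (Λ : Measure X) [IsLocallyFiniteMeasure Λ] :
    ∃ (P : Measure (ℕ → ℕ × (ℕ → X))) (χ : (ℕ → ℕ × (ℕ → X)) → LocallyFiniteMeasure X),
      IsProbabilityMeasure P ∧ Measurable χ ∧
      (∀ B, MeasurableSet B → Measurable fun ω => (χ ω).toMeasure B) ∧
      (∀ B, MeasurableSet B → ∫⁻ ω, (χ ω).toMeasure B ∂P = Λ B) ∧
      ∀ f : X → ℝ, Measurable f → Integrable f Λ →
        ∫ ω, Complex.exp ((∫ x, f x ∂(χ ω).toMeasure : ℝ) * Complex.I) ∂P =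
          Complex.exp (∫ x, (Complex.exp (f x * Complex.I) - 1) ∂Λ) := by
  obtain ⟨x₀⟩ := ‹Nonempty X›
  obtain ⟨ν, hν1, hν⟩ := exists_shell_law x₀ Λ
  refine ⟨shellLaw x₀ Λ ν, fun ω => ⟨shellSample x₀ ω, inferInstance⟩, inferInstance,
    LocallyFiniteMeasure.measurable_of_integral fun f => ?_, fun B hB => ?_, fun B hB => ?_,
    fun f hf hfΛ => integral_exp_integral_shellSample x₀ hν hf hfΛ⟩
  · obtain ⟨r, hr⟩ := f.hasCompactSupport.isCompact.isBounded.subset_ball x₀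
    obtain ⟨K, hK⟩ := exists_nat_ge r
    have hfK : ∀ x ∉ Metric.ball x₀ (K : ℝ), f x = 0 := fun x hx =>
      image_eq_zero_of_notMem_tsupport fun h => hx (Metric.ball_subset_ball hK (hr h))
    have hf : Measurable fun x => f x := f.continuous.measurable
    change Measurable fun ω => ∫ x, f x ∂shellSample x₀ ω
    simp_rw [integral_shellSample x₀ _ hf hfK]
    exact Finset.measurable_sum (Finset.range K) fun k _ =>
      (measurable_sum_range (hf.indicator (measurableSet_shell x₀ k))).comp
        (measurable_pi_apply k)
  · simpa [hB, LocallyFiniteMeasure.toMeasure] using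
      measurable_lintegral_shellSample x₀ (measurable_one.indicator hB)
  · simpa [hB, LocallyFiniteMeasure.toMeasure] using
      lintegral_lintegral_shellSample x₀ hν (measurable_one.indicator hB)

end Construction

/-! ### The Poisson property from the characteristic functional -/

/-- Evaluated at linear combinations of indicators of disjoint sets, the characteristic functional
is the joint characteristic function of independent Poisson counts. The mean is used only to see
that the counts are almost surely finite. -/
theorem isPoissonPointProcess_of_characteristic_functional {X Ω : Type*} [TopologicalSpace X]
    [MeasurableSpace X] [MeasurableSpace Ω] {P : Measure Ω} [IsProbabilityMeasure P]
    {χ : Ω → LocallyFiniteMeasure X} {Λ : Measure X} (hχ : Measurable χ)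
    (hcount : ∀ B, MeasurableSet B → Measurable fun ω => (χ ω).toMeasure B)
    (hmean : ∀ B, MeasurableSet B → ∫⁻ ω, (χ ω).toMeasure B ∂P = Λ B)
    (hchar : ∀ f : X → ℝ, Measurable f → Integrable f Λ →
      ∫ ω, Complex.exp ((∫ x, f x ∂(χ ω).toMeasure : ℝ) * Complex.I) ∂P =
        Complex.exp (∫ x, (Complex.exp (f x * Complex.I) - 1) ∂Λ)) :
    IsPoissonPointProcess χ Λ P := by
  have hfin : ∀ B, MeasurableSet B → Λ B ≠ ∞ → ∀ᵐ ω ∂P, (χ ω).toMeasure B < ∞ :=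
    fun B hB hΛ => ae_lt_top (hcount B hB) ((hmean B hB).trans_ne hΛ)
  have hreal : ∀ B, MeasurableSet B → Measurable fun ω => (χ ω).toMeasure.real B :=
    fun B hB => (hcount B hB).ennreal_toReal
  -- the joint characteristic function of the counts in disjoint sets
  have hjoint : ∀ (k : ℕ) (B : Fin k → Set X), (∀ i, MeasurableSet (B i)) →
      (∀ i, Λ (B i) ≠ ∞) → Pairwise (fun i j => Disjoint (B i) (B j)) → ∀ t : Fin k → ℝ,
      ∫ ω, Complex.exp ((∑ i, (χ ω).toMeasure.real (B i) * t i : ℝ) * Complex.I) ∂P =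
        ∏ i, Complex.exp (Λ.real (B i) * (Complex.exp (t i * Complex.I) - 1)) := by
    intro k B hB hΛ hdisj t
    let f : X → ℝ := fun x => ∑ i, (B i).indicator (fun _ => t i) x
    have hind : ∀ (μ : Measure X) i, μ (B i) ≠ ∞ →
        Integrable ((B i).indicator fun _ => t i) μ :=
      fun μ i h => (integrableOn_const h).integrable_indicator (hB i)
    have hf : Measurable f := Finset.measurable_sum _ fun i _ => measurable_const.indicator (hB i)
    have hfint := integrable_finsetSum Finset.univ fun i _ => hind Λ i (hΛ i)
    have h1 := hchar f hf hfint
    have hLHS : ∀ᵐ ω ∂P, ∫ x, f x ∂(χ ω).toMeasure = ∑ i, (χ ω).toMeasure.real (B i) * t i := by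
      filter_upwards [ae_all_iff.2 fun i => hfin (B i) (hB i) (hΛ i)] with ω hω
      rw [integral_finsetSum _ fun i _ => hind _ i (hω i).ne]
      exact Finset.sum_congr rfl fun i _ => by rw [integral_indicator_const _ (hB i), smul_eq_mul]
    have hRHS : ∀ x, Complex.exp (f x * Complex.I) - 1 =
        ∑ i, (B i).indicator (fun _ => Complex.exp (t i * Complex.I) - 1) x := by
      intro x
      by_cases hx : ∃ i, x ∈ B i
      · obtain ⟨i, hi⟩ := hx
        have hj : ∀ j, j ≠ i → x ∉ B j := fun j hj hx => (hdisj hj).ne_of_mem hx hi rfl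
        simp only [f]
        rw [Finset.sum_eq_single i (fun j _ h => Set.indicator_of_notMem (hj j h) _) (by simp),
          Finset.sum_eq_single i (fun j _ h => Set.indicator_of_notMem (hj j h) _) (by simp),
          Set.indicator_of_mem hi, Set.indicator_of_mem hi]
      · push Not at hx
        simp [f, Set.indicator_of_notMem (hx _)]
    have hc : ∀ i, Integrable ((B i).indicator fun _ => Complex.exp (t i * Complex.I) - 1) Λ :=
      fun i => (integrableOn_const (hΛ i)).integrable_indicator (hB i)
    simp_rw [hRHS] at h1
    rw [integral_finsetSum _ fun i _ => hc i, Complex.exp_sum] at h1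
    rw [← integral_congr_ae (hLHS.mono fun ω hω => by rw [← hω]), h1]
    refine Finset.prod_congr rfl fun i _ => ?_
    rw [integral_indicator_const _ (hB i), Complex.real_smul]
  have hsingle : ∀ B, MeasurableSet B → Λ B ≠ ∞ → ∀ t : ℝ,
      charFun (P.map fun ω => (χ ω).toMeasure.real B) t =
        Complex.exp (Λ.real B * (Complex.exp (t * Complex.I) - 1)) := by
    intro B hB hΛ t
    have := hjoint 1 (fun _ => B) (fun _ => hB) (fun _ => hΛ)
      (fun i j h => absurd (Subsingleton.elim i j) h) fun _ => t
    rw [charFun_apply_real, integral_map (hreal B hB).aemeasurable (by fun_prop)]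
    simpa [mul_comm, mul_assoc, mul_left_comm] using this
  refine ⟨hχ.aemeasurable, fun B hB hΛ => ⟨(hcount B hB).aemeasurable, ?_⟩,
    fun k B hB hΛ hdisj => ?_⟩
  · have hlaw : P.map (fun ω => (χ ω).toMeasure.real B) =
        (poissonMeasure (Λ B).toNNReal).map (fun k : ℕ => (k : ℝ)) := by
      have := Measure.isProbabilityMeasure_map (hreal B hB).aemeasurable (μ := P)
      refine Measure.ext_of_charFun (funext fun t => ?_)
      rw [hsingle B hB hΛ, charFun_map_cast_poissonMeasure]
      rfl
    have := congrArg (Measure.map ENNReal.ofReal) hlaw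
    rw [Measure.map_map ENNReal.measurable_ofReal (hreal B hB),
      Measure.map_map ENNReal.measurable_ofReal .of_discrete] at this
    rw [Measure.map_congr ((hfin B hB hΛ).mono fun ω hω =>
      (ENNReal.ofReal_toReal hω.ne).symm)]
    refine this.trans ?_
    congr 1
    ext k
    simp
  · have h : iIndepFun (fun i ω => (χ ω).toMeasure.real (B i)) P := by
      rw [iIndepFun_iff_charFun_pi fun i => (hreal _ (hB i)).aemeasurable]
      intro t
      simp_rw [fun i => hsingle _ (hB i) (hΛ i)]
      have hm : Measurable fun ω => WithLp.toLp 2 fun i => (χ ω).toMeasure.real (B i) :=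
        (WithLp.measurable_toLp 2 _).comp (measurable_pi_lambda _ fun i => hreal _ (hB i))
      rw [← hjoint k B hB hΛ hdisj t, charFun_apply,
        integral_map hm.aemeasurable (by fun_prop)]
      simp [PiLp.inner_apply, mul_comm]
    refine (h.comp (fun _ => ENNReal.ofReal) fun _ => ENNReal.measurable_ofReal).congr fun i => ?_
    exact (hfin _ (hB i) (hΛ i)).mono fun ω hω => ENNReal.ofReal_toReal hω.ne

/-! ### Poisson approximation for sums over pairs of independent points -/

/-- If all `1 + z i` lie in the unit disk, then `∏ (1 + z i) - 1` is at most `∑ ‖z i‖`. -/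
theorem norm_prod_one_add_sub_one_le_sum {ι : Type*} (s : Finset ι) {z : ι → ℂ}
    (hz : ∀ i, ‖1 + z i‖ ≤ 1) : ‖∏ i ∈ s, (1 + z i) - 1‖ ≤ ∑ i ∈ s, ‖z i‖ := by
  classical
  induction s using Finset.induction_on with
  | empty => simp
  | insert a s ha ih =>
    rw [Finset.prod_insert ha, Finset.sum_insert ha,
      show (1 + z a) * ∏ i ∈ s, (1 + z i) - 1 =
        z a + (1 + z a) * (∏ i ∈ s, (1 + z i) - 1) by ring]
    refine (norm_add_le _ _).trans (add_le_add le_rfl ?_)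
    rw [norm_mul]
    exact (mul_le_of_le_one_left (norm_nonneg _) (hz a)).trans ih

/-- If all `1 + z i` lie in the unit disk, then the expansion of `∏ (1 + z i)` to first order has
an error of second order. -/
theorem norm_prod_one_add_sub_sum_le {ι : Type*} [DecidableEq ι] (s : Finset ι) {z : ι → ℂ}
    (hz : ∀ i, ‖1 + z i‖ ≤ 1) :
    ‖∏ i ∈ s, (1 + z i) - 1 - ∑ i ∈ s, z i‖ ≤ ∑ i ∈ s, ∑ j ∈ s.erase i, ‖z i‖ * ‖z j‖ := by
  induction s using Finset.induction_on with
  | empty => simp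
  | insert a s ha ih =>
    rw [Finset.prod_insert ha, Finset.sum_insert ha, Finset.sum_insert ha,
      Finset.erase_insert ha,
      show (1 + z a) * ∏ i ∈ s, (1 + z i) - 1 - (z a + ∑ i ∈ s, z i) =
        z a * (∏ i ∈ s, (1 + z i) - 1) + (∏ i ∈ s, (1 + z i) - 1 - ∑ i ∈ s, z i) by ring]
    refine (norm_add_le _ _).trans (add_le_add ?_ (ih.trans ?_))
    · rw [norm_mul, ← Finset.mul_sum]
      exact mul_le_mul_of_nonneg_left (norm_prod_one_add_sub_one_le_sum s hz) (norm_nonneg _)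
    · refine Finset.sum_le_sum fun i _ => Finset.sum_le_sum_of_subset_of_nonneg
        (Finset.erase_subset_erase _ (Finset.subset_insert _ _)) fun _ _ _ => by positivity

/-- The sum of `k` over the ordered pairs of points with distinct indices in `S`. -/
def pairSum {ι E : Type*} [DecidableEq ι] (k : E → E → ℝ) (x : ι → E) (S : Finset ι) : ℝ :=
  ∑ a ∈ S, ∑ b ∈ S, if a = b then 0 else k (x a) (x b)

theorem pairSum_insert {ι E : Type*} [DecidableEq ι] (k : E → E → ℝ) (x : ι → E) {S : Finset ι}
    {i : ι} (hi : i ∉ S) :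
    pairSum k x (insert i S) = pairSum k x S + ∑ a ∈ S, (k (x i) (x a) + k (x a) (x i)) := by
  have h1 : ∀ a ∈ S, i ≠ a := fun a ha h => hi (h ▸ ha)
  simp only [pairSum, Finset.sum_insert hi, if_true, Finset.sum_add_distrib, zero_add]
  rw [Finset.sum_congr rfl fun a ha => if_neg (h1 a ha),
    Finset.sum_congr rfl fun a ha => if_neg (h1 a ha).symm]
  ring

/-- The factor `exp (i h) - 1` that belongs to an unordered pair, `h` being the contribution of
both orders of the pair. -/
noncomputable def pairFactor {E : Type*} (k : E → E → ℝ) (a b : E) : ℂ :=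
  Complex.exp ((k a b + k b a : ℝ) * Complex.I) - 1

section PairSum

variable {E : Type*} {k : E → E → ℝ}

theorem pairFactor_comm (a b : E) : pairFactor k a b = pairFactor k b a := by
  rw [pairFactor, pairFactor, add_comm]

theorem norm_one_add_pairFactor (a b : E) : ‖1 + pairFactor k a b‖ = 1 := by
  rw [pairFactor, add_sub_cancel, Complex.norm_exp_ofReal_mul_I]

theorem norm_pairFactor_le (a b : E) : ‖pairFactor k a b‖ ≤ 2 :=
  (norm_sub_le _ _).trans (by rw [Complex.norm_exp_ofReal_mul_I, norm_one]; norm_num)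

theorem re_pairFactor_nonpos (a b : E) : (pairFactor k a b).re ≤ 0 := by
  rw [pairFactor, Complex.sub_re, Complex.exp_ofReal_mul_I_re, Complex.one_re]
  linarith [Real.cos_le_one (k a b + k b a)]

theorem exp_pairSum_insert {ι : Type*} [DecidableEq ι] (x : ι → E) {S : Finset ι} {i : ι}
    (hi : i ∉ S) :
    Complex.exp (pairSum k x (insert i S) * Complex.I) =
      Complex.exp (pairSum k x S * Complex.I) * ∏ a ∈ S, (1 + pairFactor k (x i) (x a)) := by
  simp_rw [pairFactor, add_sub_cancel]
  rw [← Complex.exp_sum, ← Complex.exp_add, pairSum_insert k x hi, ← Finset.sum_mul, ← add_mul]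
  push_cast
  rfl

/-- The characteristic function, at `1`, of the sum over the pairs from `S`. -/
noncomputable def pairCharFun {ι Ω : Type*} [DecidableEq ι] [MeasurableSpace Ω] (k : E → E → ℝ)
    (x : ι → Ω → E) (P : Measure Ω) (S : Finset ι) : ℂ :=
  ∫ ω, Complex.exp (pairSum k (fun i => x i ω) S * Complex.I) ∂P

theorem norm_pairCharFun_le {ι Ω : Type*} [DecidableEq ι] [MeasurableSpace Ω] {P : Measure Ω}
    [IsProbabilityMeasure P] {x : ι → Ω → E} (S : Finset ι) : ‖pairCharFun k x P S‖ ≤ 1 := by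
  refine (norm_integral_le_integral_norm _).trans ?_
  simp_rw [Complex.norm_exp_ofReal_mul_I]
  simp

variable [MeasurableSpace E]

theorem measurable_pairFactor (hk : Measurable fun p : E × E => k p.1 p.2) :
    Measurable fun p : E × E => pairFactor k p.1 p.2 := by
  have := hk.comp measurable_swap
  simp only [Function.comp_def, Prod.fst_swap, Prod.snd_swap] at this
  unfold pairFactor
  fun_prop

theorem measurable_pairSum {ι Ω : Type*} [DecidableEq ι] [MeasurableSpace Ω] {x : ι → Ω → E}
    (hk : Measurable fun p : E × E => k p.1 p.2) (S : Finset ι) (hx : ∀ i ∈ S, Measurable (x i)) :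
    Measurable fun ω => pairSum k (fun i => x i ω) S := by
  refine Finset.measurable_sum S fun a ha => Finset.measurable_sum S fun b hb => ?_
  split_ifs
  · exact measurable_const
  · exact hk.comp ((hx a ha).prodMk (hx b hb))

theorem integrable_exp_pairSum_mul {ι Ω : Type*} [DecidableEq ι] [MeasurableSpace Ω] {P : Measure Ω}
    {x : ι → Ω → E} (hk : Measurable fun p : E × E => k p.1 p.2)
    (hx : ∀ i, Measurable (x i)) (S : Finset ι) {F : Ω → ℂ} (hF : Integrable F P) :
    Integrable (fun ω => Complex.exp (pairSum k (fun i => x i ω) S * Complex.I) * F ω) P := by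
  have := measurable_pairSum hk S fun i _ => hx i
  exact hF.bdd_mul (c := 1) (Measurable.aestronglyMeasurable (by fun_prop))
    (Eventually.of_forall fun ω => (Complex.norm_exp_ofReal_mul_I _).le)

variable {ι Ω : Type*} [MeasurableSpace Ω] {P : Measure Ω} [IsProbabilityMeasure P]
  {U : Measure E} {x : ι → Ω → E}

/-- Two different points are independent with law `U`. -/
theorem map_pair_eq_prod (hx : ∀ i, Measurable (x i)) (hlaw : ∀ i, P.map (x i) = U)
    (hind : iIndepFun x P) {i a : ι} (hia : i ≠ a) :
    P.map (fun ω => (x i ω, x a ω)) = U.prod U := by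
  rw [(indepFun_iff_map_prod_eq_prod_map_map (hx i).aemeasurable (hx a).aemeasurable).1
    (hind.indepFun hia), hlaw, hlaw]

theorem map_triple_eq_prod (hx : ∀ i, Measurable (x i)) (hlaw : ∀ i, P.map (x i) = U)
    (hind : iIndepFun x P) {i a b : ι} (hia : i ≠ a) (hib : i ≠ b) (hab : a ≠ b) :
    P.map (fun ω => (x i ω, x a ω, x b ω)) = U.prod (U.prod U) := by
  rw [(indepFun_iff_map_prod_eq_prod_map_map (hx i).aemeasurable
    ((hx a).prodMk (hx b)).aemeasurable).1 (hind.indepFun_prodMk hx a b i hia.symm hib.symm).symm,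
    hlaw, map_pair_eq_prod hx hlaw hind hab]

theorem integrable_pairFactor (hk : Measurable fun p : E × E => k p.1 p.2)
    (μ : Measure (E × E)) [IsFiniteMeasure μ] :
    Integrable (fun p : E × E => pairFactor k p.1 p.2) μ :=
  Integrable.of_bound (measurable_pairFactor hk).aestronglyMeasurable 2
    (Eventually.of_forall fun p => norm_pairFactor_le p.1 p.2)

theorem integral_norm_pairFactor_le [IsProbabilityMeasure U]
    (hk : Measurable fun p : E × E => k p.1 p.2)
    (hx : ∀ i, Measurable (x i)) (hlaw : ∀ i, P.map (x i) = U)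
    (hind : iIndepFun x P) {q : ℝ} (hq : ∀ a, ∫ b, ‖pairFactor k a b‖ ∂U ≤ q) {i a : ι}
    (hia : i ≠ a) : ∫ ω, ‖pairFactor k (x i ω) (x a ω)‖ ∂P ≤ q := by
  have h := integral_map (μ := P) ((hx i).prodMk (hx a)).aemeasurable
    (f := fun p : E × E => ‖pairFactor k p.1 p.2‖)
    (measurable_pairFactor hk).norm.aestronglyMeasurable
  rw [← h, map_pair_eq_prod hx hlaw hind hia, integral_prod _ (integrable_pairFactor hk _).norm]
  refine (integral_mono (integrable_pairFactor hk _).norm.integral_prod_left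
    (integrable_const q) hq).trans ?_
  simp

/-- Two pairs with a common point are independent given this point. -/
theorem integral_mul_pair_le [IsProbabilityMeasure U] (hx : ∀ i, Measurable (x i))
    (hlaw : ∀ i, P.map (x i) = U) (hind : iIndepFun x P) {g : E → E → ℝ}
    (hg : Measurable fun p : E × E => g p.1 p.2) (hg0 : ∀ a b, 0 ≤ g a b) {c : ℝ}
    (hgc : ∀ a b, g a b ≤ c) {q : ℝ} (hq : ∀ a, ∫ b, g a b ∂U ≤ q) {i a b : ι}
    (hia : i ≠ a) (hib : i ≠ b) (hab : a ≠ b) :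
    ∫ ω, g (x i ω) (x a ω) * g (x i ω) (x b ω) ∂P ≤ q ^ 2 := by
  have hm3 : Measurable fun p : E × E × E => g p.1 p.2.1 * g p.1 p.2.2 := by
    have h1 : Measurable fun p : E × E × E => (p.1, p.2.1) := by fun_prop
    have h2 : Measurable fun p : E × E × E => (p.1, p.2.2) := by fun_prop
    exact (hg.comp h1).mul (hg.comp h2)
  have h := integral_map (μ := P) ((hx i).prodMk ((hx a).prodMk (hx b))).aemeasurable
    (f := fun p : E × E × E => g p.1 p.2.1 * g p.1 p.2.2) hm3.aestronglyMeasurable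
  have hint : Integrable (fun p : E × E × E => g p.1 p.2.1 * g p.1 p.2.2)
      (U.prod (U.prod U)) :=
    Integrable.of_bound hm3.aestronglyMeasurable (c * c) (Eventually.of_forall fun p => by
      rw [Real.norm_of_nonneg (mul_nonneg (hg0 _ _) (hg0 _ _))]
      exact mul_le_mul (hgc _ _) (hgc _ _) (hg0 _ _) ((hg0 p.1 p.1).trans (hgc _ _)))
  rw [← h, map_triple_eq_prod hx hlaw hind hia hib hab, integral_prod _ hint]
  have hin : ∀ c, ∫ y, g c y.1 * g c y.2 ∂U.prod U ≤ q ^ 2 := by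
    intro c
    rw [integral_prod_mul (fun y => g c y) fun y => g c y, ← pow_two]
    exact pow_le_pow_left₀ (integral_nonneg fun _ => hg0 _ _) (hq c) 2
  have hmono := integral_mono hint.integral_prod_left (integrable_const (q ^ 2)) hin
  rwa [integral_const, probReal_univ, one_smul] at hmono

theorem integral_norm_pairFactor_mul_le [IsProbabilityMeasure U]
    (hk : Measurable fun p : E × E => k p.1 p.2)
    (hx : ∀ i, Measurable (x i)) (hlaw : ∀ i, P.map (x i) = U)
    (hind : iIndepFun x P) {q : ℝ} (hq : ∀ a, ∫ b, ‖pairFactor k a b‖ ∂U ≤ q) {i a b : ι}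
    (hia : i ≠ a) (hib : i ≠ b) (hab : a ≠ b) :
    ∫ ω, ‖pairFactor k (x i ω) (x a ω)‖ * ‖pairFactor k (x i ω) (x b ω)‖ ∂P ≤ q ^ 2 :=
  integral_mul_pair_le hx hlaw hind (measurable_pairFactor hk).norm (fun _ _ => norm_nonneg _)
    norm_pairFactor_le hq hia hib hab

theorem integrable_pairFactor_comp (hk : Measurable fun p : E × E => k p.1 p.2)
    (hx : ∀ i, Measurable (x i)) (i a : ι) :
    Integrable (fun ω => pairFactor k (x i ω) (x a ω)) P :=
  Integrable.of_bound ((measurable_pairFactor hk).comp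
    ((hx i).prodMk (hx a))).aestronglyMeasurable 2
    (Eventually.of_forall fun _ => norm_pairFactor_le _ _)

variable [DecidableEq ι]

/-- A pair of points outside `T` is independent of the sum over the pairs from `T`. -/
theorem integral_exp_pairSum_mul_pairFactor (hk : Measurable fun p : E × E => k p.1 p.2)
    (hx : ∀ i, Measurable (x i)) (hlaw : ∀ i, P.map (x i) = U)
    (hind : iIndepFun x P) {T : Finset ι} {i a : ι} (hi : i ∉ T) (ha : a ∉ T) (hia : i ≠ a) :
    ∫ ω, Complex.exp (pairSum k (fun i => x i ω) T * Complex.I) *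
        pairFactor k (x i ω) (x a ω) ∂P =
      (∫ ω, Complex.exp (pairSum k (fun i => x i ω) T * Complex.I) ∂P) *
        ∫ p, pairFactor k p.1 p.2 ∂U.prod U := by
  let F : (T → E) → ℂ := fun y => Complex.exp
    ((∑ c ∈ T, ∑ d ∈ T, if c = d then 0 else
      if h : c ∈ T ∧ d ∈ T then k (y ⟨c, h.1⟩) (y ⟨d, h.2⟩) else 0 : ℝ) * Complex.I)
  have hF : Measurable F := by
    have : Measurable fun y : T → E => ∑ c ∈ T, ∑ d ∈ T, if c = d then 0 else
        if h : c ∈ T ∧ d ∈ T then k (y ⟨c, h.1⟩) (y ⟨d, h.2⟩) else 0 := by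
      refine Finset.measurable_sum T fun c hc => Finset.measurable_sum T fun d hd => ?_
      simp only [hc, hd, and_self, dif_pos]
      split_ifs
      · exact measurable_const
      · have h2 : Measurable fun y : T → E => (y ⟨c, hc⟩, y ⟨d, hd⟩) := by fun_prop
        exact hk.comp h2
    fun_prop
  have hFx : ∀ ω, Complex.exp (pairSum k (fun i => x i ω) T * Complex.I) =
      F fun c => x c ω := by
    intro ω
    simp only [F, pairSum]
    congr 3
    refine Finset.sum_congr rfl fun c hc => Finset.sum_congr rfl fun d hd => ?_
    rw [dif_pos ⟨hc, hd⟩]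
  let G : (({i, a} : Finset ι) → E) → ℂ := fun y =>
    pairFactor k (y ⟨i, by simp⟩) (y ⟨a, by simp⟩)
  have hG : Measurable G := by
    have h2 : Measurable fun y : ({i, a} : Finset ι) → E => (y ⟨i, by simp⟩, y ⟨a, by simp⟩) := by
      fun_prop
    exact (measurable_pairFactor hk).comp h2
  have hdisj : Disjoint T {i, a} := by simp [hi, ha]
  have hindep := (hind.indepFun_finset T {i, a} hdisj hx).comp hF hG
  have hpair := integral_map (μ := P) ((hx i).prodMk (hx a)).aemeasurable
    (f := fun p : E × E => pairFactor k p.1 p.2) (measurable_pairFactor hk).aestronglyMeasurable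
  rw [map_pair_eq_prod hx hlaw hind hia] at hpair
  simp_rw [hFx, hpair]
  refine hindep.integral_fun_mul_eq_mul_integral ?_ ?_
  · exact (hF.comp (measurable_pi_lambda _ fun c => hx c)).aestronglyMeasurable
  · exact (hG.comp (measurable_pi_lambda _ fun c => hx c)).aestronglyMeasurable

variable [IsProbabilityMeasure U]

theorem norm_integral_pairFactor_le (hk : Measurable fun p : E × E => k p.1 p.2)
    {q : ℝ} (hq : ∀ a, ∫ b, ‖pairFactor k a b‖ ∂U ≤ q) :
    ‖∫ p, pairFactor k p.1 p.2 ∂U.prod U‖ ≤ q := by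
  refine (norm_integral_le_integral_norm _).trans ?_
  rw [integral_prod _ (integrable_pairFactor hk _).norm]
  have h := integral_mono (integrable_pairFactor hk (U.prod U)).norm.integral_prod_left
    (integrable_const q) hq
  rwa [integral_const, probReal_univ, one_smul] at h

theorem norm_pairCharFun_insert_sub_le (hk : Measurable fun p : E × E => k p.1 p.2)
    (hx : ∀ i, Measurable (x i)) (hlaw : ∀ i, P.map (x i) = U)
    (hind : iIndepFun x P) {q : ℝ} (hq : ∀ a, ∫ b, ‖pairFactor k a b‖ ∂U ≤ q) {S : Finset ι}
    {i : ι} (hi : i ∉ S) :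
    ‖pairCharFun k x P (insert i S) - pairCharFun k x P S‖ ≤ S.card * q := by
  have hone := integrable_exp_pairSum_mul hk hx S (integrable_const (1 : ℂ)) (P := P)
  have hone' := integrable_exp_pairSum_mul hk hx (insert i S) (integrable_const (1 : ℂ)) (P := P)
  simp only [mul_one] at hone hone'
  rw [pairCharFun, pairCharFun, ← integral_sub hone' hone]
  refine (norm_integral_le_of_norm_le (g := fun ω => ∑ a ∈ S, ‖pairFactor k (x i ω) (x a ω)‖)
    (integrable_finsetSum _ fun a _ => (integrable_pairFactor_comp hk hx i a).norm)
    (Eventually.of_forall fun ω => ?_)).trans ?_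
  · rw [exp_pairSum_insert _ hi, ← mul_sub_one, norm_mul, Complex.norm_exp_ofReal_mul_I, one_mul]
    exact norm_prod_one_add_sub_one_le_sum S fun a => (norm_one_add_pairFactor _ _).le
  · rw [integral_finsetSum _ fun a _ => (integrable_pairFactor_comp hk hx i a).norm]
    refine (Finset.sum_le_card_nsmul S _ q fun a ha => ?_).trans_eq (nsmul_eq_mul _ _)
    exact integral_norm_pairFactor_le hk hx hlaw hind hq (ne_of_mem_of_not_mem ha hi).symm

/-- A pair factor with one point in `S` and one outside may be averaged separately, up to the
small probability of a second pair at the point in `S`. -/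
theorem norm_integral_exp_pairSum_mul_pairFactor_sub_le
    (hk : Measurable fun p : E × E => k p.1 p.2)
    (hx : ∀ i, Measurable (x i)) (hlaw : ∀ i, P.map (x i) = U)
    (hind : iIndepFun x P) {q : ℝ} (hq : ∀ a, ∫ b, ‖pairFactor k a b‖ ∂U ≤ q) {S : Finset ι}
    {i a : ι} (hi : i ∉ S) (ha : a ∈ S) :
    ‖∫ ω, Complex.exp (pairSum k (fun i => x i ω) S * Complex.I) *
        pairFactor k (x i ω) (x a ω) ∂P -
      pairCharFun k x P S * ∫ p, pairFactor k p.1 p.2 ∂U.prod U‖ ≤ 2 * S.card * q ^ 2 := by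
  have hq0 : 0 ≤ q := (norm_nonneg _).trans (norm_integral_pairFactor_le hk hq)
  obtain ⟨T, haT, rfl⟩ : ∃ T, a ∉ T ∧ insert a T = S :=
    ⟨S.erase a, Finset.notMem_erase a S, Finset.insert_erase ha⟩
  have hiT : i ∉ T := fun h => hi (Finset.mem_insert_of_mem h)
  have hia : i ≠ a := (ne_of_mem_of_not_mem ha hi).symm
  have hcard : (T.card : ℝ) ≤ (insert a T).card :=
    Nat.cast_le.2 (Finset.card_le_card (Finset.subset_insert a T))
  set γ := ∫ p, pairFactor k p.1 p.2 ∂U.prod U with hγ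
  have hmul : ∀ S : Finset ι, Integrable (fun ω =>
      Complex.exp (pairSum k (fun i => x i ω) S * Complex.I) * pairFactor k (x i ω) (x a ω)) P :=
    fun S => integrable_exp_pairSum_mul hk hx S (integrable_pairFactor_comp hk hx i a)
  have hprod : ∀ b, Integrable (fun ω =>
      ‖pairFactor k (x a ω) (x i ω)‖ * ‖pairFactor k (x a ω) (x b ω)‖) P := fun b =>
    (integrable_pairFactor_comp hk hx a b).norm.bdd_mul (c := 2)
      (integrable_pairFactor_comp hk hx a i).norm.aestronglyMeasurable
      (Eventually.of_forall fun ω => (norm_norm _).trans_le (norm_pairFactor_le _ _))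
  have h1 : ‖∫ ω, Complex.exp (pairSum k (fun i => x i ω) (insert a T) * Complex.I) *
        pairFactor k (x i ω) (x a ω) ∂P -
      ∫ ω, Complex.exp (pairSum k (fun i => x i ω) T * Complex.I) *
        pairFactor k (x i ω) (x a ω) ∂P‖ ≤ T.card * q ^ 2 := by
    rw [← integral_sub (hmul _) (hmul _)]
    refine (norm_integral_le_of_norm_le (g := fun ω => ∑ b ∈ T,
      ‖pairFactor k (x a ω) (x i ω)‖ * ‖pairFactor k (x a ω) (x b ω)‖)
      (integrable_finsetSum _ fun b _ => hprod b) (Eventually.of_forall fun ω => ?_)).trans ?_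
    · rw [exp_pairSum_insert _ haT, ← sub_mul, ← mul_sub_one, norm_mul, norm_mul,
        Complex.norm_exp_ofReal_mul_I, one_mul, mul_comm, ← Finset.mul_sum, pairFactor_comm]
      exact mul_le_mul_of_nonneg_left (norm_prod_one_add_sub_one_le_sum T
        (z := fun b => pairFactor k (x a ω) (x b ω))
        fun b => (norm_one_add_pairFactor _ _).le) (norm_nonneg _)
    · rw [integral_finsetSum _ fun b _ => hprod b]
      refine (Finset.sum_le_card_nsmul T _ (q ^ 2) fun b hb => ?_).trans_eq (nsmul_eq_mul _ _)
      exact integral_norm_pairFactor_mul_le hk hx hlaw hind hq hia.symm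
        (ne_of_mem_of_not_mem hb haT).symm (ne_of_mem_of_not_mem hb hiT).symm
  rw [integral_exp_pairSum_mul_pairFactor hk hx hlaw hind hiT haT hia, ← hγ] at h1
  have h2 : ‖pairCharFun k x P T * γ - pairCharFun k x P (insert a T) * γ‖ ≤
      T.card * q ^ 2 := by
    rw [← sub_mul, norm_mul, norm_sub_rev, pow_two, ← mul_assoc]
    exact mul_le_mul (norm_pairCharFun_insert_sub_le hk hx hlaw hind hq haT)
      (norm_integral_pairFactor_le hk hq) (norm_nonneg _) (by positivity)
  refine (norm_sub_le_norm_sub_add_norm_sub _ (pairCharFun k x P T * γ) _).trans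
    ((add_le_add h1 h2).trans ?_)
  rw [← two_mul, ← mul_assoc]
  gcongr

/-- Adding one point multiplies the characteristic function by nearly `1 + |S| γ`, where `γ` is
the mean of a pair factor. -/
theorem norm_pairCharFun_insert_sub_mul_le (hk : Measurable fun p : E × E => k p.1 p.2)
    (hx : ∀ i, Measurable (x i)) (hlaw : ∀ i, P.map (x i) = U)
    (hind : iIndepFun x P) {q : ℝ} (hq : ∀ a, ∫ b, ‖pairFactor k a b‖ ∂U ≤ q) {S : Finset ι}
    {i : ι} (hi : i ∉ S) :
    ‖pairCharFun k x P (insert i S) -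
      pairCharFun k x P S * (1 + S.card * ∫ p, pairFactor k p.1 p.2 ∂U.prod U)‖ ≤
        3 * S.card ^ 2 * q ^ 2 := by
  set γ := ∫ p, pairFactor k p.1 p.2 ∂U.prod U with hγ
  let e : Ω → ℂ := fun ω => Complex.exp (pairSum k (fun i => x i ω) S * Complex.I)
  let z : ι → Ω → ℂ := fun a ω => pairFactor k (x i ω) (x a ω)
  have hz : ∀ a, Integrable (z a) P := fun a => integrable_pairFactor_comp hk hx i a
  have he : ∀ {F : Ω → ℂ}, Integrable F P → Integrable (fun ω => e ω * F ω) P :=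
    fun hF => integrable_exp_pairSum_mul hk hx S hF
  have he1 : Integrable e P := by simpa using he (integrable_const (1 : ℂ))
  have hzz : ∀ a b, Integrable (fun ω => ‖z a ω‖ * ‖z b ω‖) P := fun a b =>
    (hz b).norm.bdd_mul (c := 2) (hz a).norm.aestronglyMeasurable
      (Eventually.of_forall fun ω => (norm_norm _).trans_le (norm_pairFactor_le _ _))
  have hsum : Integrable (fun ω => ∑ a ∈ S, e ω * z a ω) P :=
    integrable_finsetSum _ fun a _ => he (hz a)
  have hins : Integrable
      (fun ω => Complex.exp (pairSum k (fun i => x i ω) (insert i S) * Complex.I)) P := by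
    simpa using integrable_exp_pairSum_mul hk hx (insert i S) (integrable_const (1 : ℂ)) (P := P)
  have hadd : Integrable (fun ω => e ω + ∑ a ∈ S, e ω * z a ω) P := he1.add hsum
  have h1 : ‖pairCharFun k x P (insert i S) -
      (pairCharFun k x P S + ∑ a ∈ S, ∫ ω, e ω * z a ω ∂P)‖ ≤ S.card * (S.card * q ^ 2) := by
    rw [← integral_finsetSum _ fun a _ => he (hz a), pairCharFun, pairCharFun,
      ← integral_add he1 hsum, ← integral_sub hins hadd]
    refine (norm_integral_le_of_norm_le
      (g := fun ω => ∑ a ∈ S, ∑ b ∈ S.erase a, ‖z a ω‖ * ‖z b ω‖)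
      (integrable_finsetSum _ fun a _ => integrable_finsetSum _ fun b _ => hzz a b)
      (Eventually.of_forall fun ω => ?_)).trans ?_
    · rw [exp_pairSum_insert _ hi, ← Finset.mul_sum]
      change ‖e ω * ∏ a ∈ S, (1 + z a ω) - (e ω + e ω * ∑ a ∈ S, z a ω)‖ ≤ _
      rw [show e ω * ∏ a ∈ S, (1 + z a ω) - (e ω + e ω * ∑ a ∈ S, z a ω) =
        e ω * (∏ a ∈ S, (1 + z a ω) - 1 - ∑ a ∈ S, z a ω) by ring, norm_mul,
        Complex.norm_exp_ofReal_mul_I, one_mul]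
      exact norm_prod_one_add_sub_sum_le S fun a => (norm_one_add_pairFactor _ _).le
    · rw [integral_finsetSum _ fun a _ => integrable_finsetSum _ fun b _ => hzz a b]
      refine (Finset.sum_le_card_nsmul S _ (S.card * q ^ 2) fun a ha => ?_).trans_eq
        (nsmul_eq_mul _ _)
      rw [integral_finsetSum _ fun b _ => hzz a b]
      refine (Finset.sum_le_card_nsmul _ _ (q ^ 2) fun b hb => ?_).trans ?_
      · rw [Finset.mem_erase] at hb
        exact integral_norm_pairFactor_mul_le hk hx hlaw hind hq
          (ne_of_mem_of_not_mem ha hi).symm (ne_of_mem_of_not_mem hb.2 hi).symm hb.1.symm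
      · rw [nsmul_eq_mul]
        gcongr
        exact Finset.erase_subset _ _
  have h2 : ‖(pairCharFun k x P S + ∑ a ∈ S, ∫ ω, e ω * z a ω ∂P) -
      pairCharFun k x P S * (1 + S.card * γ)‖ ≤ S.card * (2 * S.card * q ^ 2) := by
    rw [show (pairCharFun k x P S + ∑ a ∈ S, ∫ ω, e ω * z a ω ∂P) -
      pairCharFun k x P S * (1 + S.card * γ) =
        ∑ a ∈ S, (∫ ω, e ω * z a ω ∂P - pairCharFun k x P S * γ) by
      rw [Finset.sum_sub_distrib, Finset.sum_const, nsmul_eq_mul]; ring]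
    refine (norm_sum_le_of_le S (n := fun _ => 2 * S.card * q ^ 2) fun a ha =>
      norm_integral_exp_pairSum_mul_pairFactor_sub_le hk hx hlaw hind hq hi ha).trans_eq ?_
    rw [Finset.sum_const, nsmul_eq_mul]
  refine (norm_sub_le_norm_sub_add_norm_sub _ _ _).trans ((add_le_add h1 h2).trans_eq ?_)
  ring

/-- **Poisson approximation.** When the pair factors are of order `q` in mean, the characteristic
function of the sum over all pairs of `m` points is `exp (m (m - 1) / 2 * γ)`, up to an error of
order `m ^ 3 * q ^ 2`. -/
theorem norm_pairCharFun_sub_exp_le (hk : Measurable fun p : E × E => k p.1 p.2)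
    (hx : ∀ i, Measurable (x i)) (hlaw : ∀ i, P.map (x i) = U)
    (hind : iIndepFun x P) {q : ℝ} (hq : ∀ a, ∫ b, ‖pairFactor k a b‖ ∂U ≤ q) (S : Finset ι)
    (hS : S.card * q ≤ 1) :
    ‖pairCharFun k x P S - Complex.exp (S.card * (S.card - 1) / 2 *
      ∫ p, pairFactor k p.1 p.2 ∂U.prod U)‖ ≤ 4 * S.card ^ 3 * q ^ 2 := by
  set γ := ∫ p, pairFactor k p.1 p.2 ∂U.prod U with hγ
  have hγq : ‖γ‖ ≤ q := norm_integral_pairFactor_le hk hq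
  have hq0 : 0 ≤ q := (norm_nonneg _).trans hγq
  have hγre : γ.re ≤ 0 := by
    have h := integral_nonpos (μ := U.prod U) fun p : E × E => re_pairFactor_nonpos (k := k) p.1 p.2
    have h' := integral_re (integrable_pairFactor hk (U.prod U)) (𝕜 := ℂ)
    simp only [RCLike.re_to_complex] at h'
    rwa [h'] at h
  induction S using Finset.induction_on with
  | empty => simp [pairCharFun, pairSum]
  | insert i S hi ih =>
    rw [Finset.card_insert_of_notMem hi] at hS ⊢
    push_cast at hS ⊢
    set m : ℝ := (S.card : ℝ)
    have hm : 0 ≤ m := Nat.cast_nonneg _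
    have hmq : m * q ≤ 1 := (by nlinarith : m * q ≤ (m + 1) * q).trans hS
    -- as `re γ ≤ 0`, multiplication by `exp (m γ)` does not enlarge the error made so far
    have hexp : ‖Complex.exp (S.card * γ)‖ ≤ 1 := by
      rw [Complex.norm_exp, ← Complex.ofReal_natCast, Complex.re_ofReal_mul]
      exact Real.exp_le_one_iff.2 (mul_nonpos_of_nonneg_of_nonpos hm hγre)
    have hz : ‖(S.card : ℂ) * γ‖ ≤ m * q := by
      rw [norm_mul, Complex.norm_natCast]
      gcongr
    have h1 := norm_pairCharFun_insert_sub_mul_le hk hx hlaw hind hq hi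
    rw [← hγ] at h1
    have h2 : ‖pairCharFun k x P S * (1 + S.card * γ) -
        pairCharFun k x P S * Complex.exp (S.card * γ)‖ ≤ m ^ 2 * q ^ 2 := by
      rw [← mul_sub, norm_mul, norm_sub_rev, ← sub_sub, ← mul_pow]
      refine (mul_le_of_le_one_left (norm_nonneg _) (norm_pairCharFun_le S)).trans ?_
      exact (Complex.norm_exp_sub_one_sub_id_le (hz.trans hmq)).trans
        (pow_le_pow_left₀ (norm_nonneg _) hz 2)
    have h3 : ‖pairCharFun k x P S * Complex.exp (S.card * γ) -
        Complex.exp ((S.card + 1) * (S.card + 1 - 1) / 2 * γ)‖ ≤ 4 * m ^ 3 * q ^ 2 := by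
      rw [show ((S.card : ℂ) + 1) * (S.card + 1 - 1) / 2 * γ =
        S.card * (S.card - 1) / 2 * γ + S.card * γ by ring, Complex.exp_add, ← sub_mul, norm_mul]
      exact (mul_le_of_le_one_right (norm_nonneg _) hexp).trans (ih hmq)
    refine (norm_sub_le_norm_sub_add_norm_sub _ (pairCharFun k x P S * (1 + S.card * γ)) _).trans ?_
    refine (add_le_add h1 ((norm_sub_le_norm_sub_add_norm_sub _
      (pairCharFun k x P S * Complex.exp (S.card * γ)) _).trans (add_le_add h2 h3))).trans ?_
    have : 0 ≤ q ^ 2 * (8 * m ^ 2 + 12 * m + 4) := by positivity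
    change 3 * m ^ 2 * q ^ 2 + (m ^ 2 * q ^ 2 + 4 * m ^ 3 * q ^ 2) ≤ 4 * (m + 1) ^ 3 * q ^ 2
    linarith [show 4 * (m + 1) ^ 3 * q ^ 2 - (3 * m ^ 2 * q ^ 2 + (m ^ 2 * q ^ 2 +
      4 * m ^ 3 * q ^ 2)) = q ^ 2 * (8 * m ^ 2 + 12 * m + 4) by ring]

end PairSum

/-! ### The intensity measure -/

/-- The uniform distribution on the unit disk. -/
noncomputable def diskLaw : Measure ℂ :=
  (ENNReal.ofReal Real.pi)⁻¹ • (volume.restrict (Metric.ball (0 : ℂ) 1))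

/-- The measure `r dr` on `[0, ∞)`. -/
noncomputable def radialMeasure : Measure ℝ≥0 :=
  ((volume.restrict (Set.Ici (0 : ℝ))).withDensity fun r => ENNReal.ofReal r).map Real.toNNReal

theorem gapIntensity_eq_prod : gapIntensity = radialMeasure.prod diskLaw := rfl

theorem volume_unitBall : volume (Metric.ball (0 : ℂ) 1) = ENNReal.ofReal Real.pi := by
  rw [Complex.volume_ball, ENNReal.ofReal_one, one_pow, one_mul, ← NNReal.coe_real_pi,
    ENNReal.ofReal_coe_nnreal]

theorem cond_unitBall : volume[|Metric.ball (0 : ℂ) 1] = diskLaw := by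
  rw [ProbabilityTheory.cond, volume_unitBall, diskLaw]

instance : IsProbabilityMeasure diskLaw := by
  rw [← cond_unitBall]
  exact cond_isProbabilityMeasure_of_finite (Metric.measure_ball_pos volume 0 one_pos).ne'
    measure_ball_lt_top.ne

theorem integral_diskLaw {F : Type*} [NormedAddCommGroup F] [NormedSpace ℝ F] (g : ℂ → F) :
    ∫ z, g z ∂diskLaw = Real.pi⁻¹ • ∫ z in Metric.ball (0 : ℂ) 1, g z := by
  rw [diskLaw, integral_smul_measure, ENNReal.toReal_inv, ENNReal.toReal_ofReal Real.pi_pos.le]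

theorem diskLaw_real_closedBall_le (a : ℂ) {r : ℝ} (hr : 0 ≤ r) :
    diskLaw.real (Metric.closedBall a r) ≤ r ^ 2 := by
  refine ENNReal.toReal_le_of_le_ofReal (by positivity) ?_
  have hpi : ENNReal.ofReal Real.pi ≠ 0 := by simp [Real.pi_pos]
  calc diskLaw (Metric.closedBall a r)
      ≤ (ENNReal.ofReal Real.pi)⁻¹ * volume (Metric.closedBall a r) := by
        rw [diskLaw, Measure.smul_apply, smul_eq_mul]
        gcongr
        exact Measure.restrict_le_self
    _ = ENNReal.ofReal (r ^ 2) := by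
        rw [Complex.volume_closedBall, ← ENNReal.ofReal_coe_nnreal, NNReal.coe_real_pi, mul_comm,
          mul_assoc, ENNReal.mul_inv_cancel hpi ENNReal.ofReal_ne_top, mul_one,
          ENNReal.ofReal_pow hr]

theorem radialMeasure_apply {A : Set ℝ≥0} (hA : MeasurableSet A) :
    radialMeasure A = ∫⁻ r in (fun a : ℝ≥0 => (a : ℝ)) '' A, ENNReal.ofReal r := by
  have himage : (fun a : ℝ≥0 => (a : ℝ)) '' A = Real.toNNReal ⁻¹' A ∩ Set.Ici 0 := by
    ext r
    constructor
    · rintro ⟨a, ha, rfl⟩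
      exact ⟨by simpa using ha, a.2⟩
    · rintro ⟨hr, h0⟩
      exact ⟨r.toNNReal, hr, Real.coe_toNNReal r h0⟩
  have hpre := measurable_real_toNNReal hA
  rw [radialMeasure, Measure.map_apply measurable_real_toNNReal hA, withDensity_apply _ hpre,
    Measure.restrict_restrict hpre, himage]

instance : IsLocallyFiniteMeasure radialMeasure := by
  refine ⟨fun x => ⟨Set.Iio (x + 1), Iio_mem_nhds (lt_add_one x), ?_⟩⟩
  rw [radialMeasure_apply measurableSet_Iio]
  calc ∫⁻ r in (fun a : ℝ≥0 => (a : ℝ)) '' Set.Iio (x + 1), ENNReal.ofReal r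
      ≤ ∫⁻ r in Set.Icc (0 : ℝ) (x + 1), ENNReal.ofReal (x + 1) := by
        refine (lintegral_mono_set ?_).trans (setLIntegral_mono measurable_const fun r hr =>
          ENNReal.ofReal_le_ofReal hr.2)
        rintro _ ⟨a, ha, rfl⟩
        exact ⟨a.2, (NNReal.coe_lt_coe.2 ha).le⟩
    _ < ∞ := by
        rw [setLIntegral_const, Real.volume_Icc]
        exact ENNReal.mul_lt_top ENNReal.ofReal_lt_top ENNReal.ofReal_lt_top

instance : IsLocallyFiniteMeasure gapIntensity := by
  rw [gapIntensity_eq_prod]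
  infer_instance

theorem gapIntensity_prod {A : Set ℝ≥0} (hA : MeasurableSet A) {I : Set ℂ}
    (hI : MeasurableSet I) :
    gapIntensity (A ×ˢ I) = volume (I ∩ Metric.ball (0 : ℂ) 1) / ENNReal.ofReal Real.pi *
      ∫⁻ r in ((fun a : ℝ≥0 => (a : ℝ)) '' A), ENNReal.ofReal r := by
  rw [gapIntensity_eq_prod, Measure.prod_prod, radialMeasure_apply hA, diskLaw,
    Measure.smul_apply, Measure.restrict_apply hI, smul_eq_mul, mul_comm, div_eq_mul_inv,
    mul_comm (volume _)]

/-- The endpoint `0` is dropped to match the form of `integral_fun_norm_addHaar`. -/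
theorem integral_radialMeasure {g : ℝ≥0 → ℂ} (hg : Measurable g) :
    ∫ r, g r ∂radialMeasure = ∫ r in Set.Ioi (0 : ℝ), r • g r.toNNReal := by
  rw [radialMeasure, integral_map measurable_real_toNNReal.aemeasurable
    hg.aestronglyMeasurable, integral_withDensity_eq_integral_toReal_smul
    ENNReal.measurable_ofReal (Eventually.of_forall fun _ => ENNReal.ofReal_lt_top),
    integral_Ici_eq_integral_Ioi]
  refine setIntegral_congr_fun measurableSet_Ioi fun r hr => ?_
  simp only [ENNReal.toReal_ofReal (le_of_lt hr)]

/-! ### The lexicographic order -/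

theorem lexLE_sub_iff (a b : ℂ) : LexLE a b ↔ LexLE 0 (b - a) := by
  simp only [LexLE, Complex.sub_im, Complex.sub_re, Complex.zero_im, Complex.zero_re, sub_pos,
    sub_nonneg, eq_comm (a := (0 : ℝ)), sub_eq_zero, eq_comm (a := b.im)]

theorem lexLE_zero_smul_iff {t : ℝ} (ht : 0 < t) (u : ℂ) : LexLE 0 (t • u) ↔ LexLE 0 u := by
  simp [LexLE, ht, ht.ne', eq_comm (a := (0 : ℝ))]

theorem lexLE_total (a b : ℂ) : LexLE a b ∨ LexLE b a := by
  rcases lt_trichotomy a.im b.im with h | h | h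
  · exact .inl (.inl h)
  · exact (le_total a.re b.re).imp (fun h' => .inr ⟨h, h'⟩) fun h' => .inr ⟨h.symm, h'⟩
  · exact .inr (.inl h)

theorem lexLE_antisymm {a b : ℂ} (hab : LexLE a b) (hba : LexLE b a) : a = b := by
  unfold LexLE at hab hba
  refine Complex.ext ?_ ?_ <;> grind

theorem measurableSet_lexLE : MeasurableSet {p : ℂ × ℂ | LexLE p.1 p.2} := by
  unfold LexLE
  measurability

/-- The half-plane `{u | 0 ⪯ u}` and its reflection cover the plane and meet only in `0`, so that
a radial function has half its integral over the half-plane. -/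
theorem integral_lexLE_zero_norm {g : ℝ≥0 → ℂ} (hg : Measurable g)
    (hint : Integrable fun u : ℂ => g ‖u‖₊) :
    ∫ u : ℂ, {u | LexLE 0 u}.indicator (fun u => g ‖u‖₊) u = Real.pi * ∫ r, g r ∂radialMeasure := by
  have hmeas : MeasurableSet {u : ℂ | LexLE 0 u} := measurableSet_lexLE.preimage
    (measurable_const.prodMk measurable_id)
  have hhalf := hint.indicator hmeas
  have hsum : (∫ u : ℂ, {u | LexLE 0 u}.indicator (fun u => g ‖u‖₊) u) +
      (∫ u : ℂ, {u | LexLE 0 u}.indicator (fun u => g ‖u‖₊) u) = ∫ u : ℂ, g ‖u‖₊ := by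
    nth_rewrite 2 [← integral_neg_eq_self]
    rw [← integral_add hhalf hhalf.comp_neg]
    have h0 : ∀ᵐ u : ℂ, u ≠ 0 := by simp [ae_iff]
    refine integral_congr_ae ?_
    filter_upwards [h0] with u hu
    have hneg : LexLE 0 (-u) ↔ LexLE u 0 := by rw [lexLE_sub_iff u 0, zero_sub]
    by_cases h1 : LexLE 0 u
    · have h2 : -u ∉ {u | LexLE 0 u} := fun h2 => hu (lexLE_antisymm (hneg.1 h2) h1)
      rw [Set.indicator_of_mem (show u ∈ {u | LexLE 0 u} from h1), Set.indicator_of_notMem h2,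
        add_zero]
    · have h1' : u ∉ {u | LexLE 0 u} := h1
      have h2 : LexLE 0 (-u) := hneg.2 ((lexLE_total 0 u).resolve_left h1)
      rw [Set.indicator_of_notMem h1', Set.indicator_of_mem (show -u ∈ {u | LexLE 0 u} from h2),
        zero_add, nnnorm_neg]
  have hpolar := integral_fun_norm_addHaar (volume : Measure ℂ) fun y => g y.toNNReal
  simp only [norm_toNNReal, Complex.finrank_real_complex, measureReal_def, volume_unitBall,
    ENNReal.toReal_ofReal Real.pi_pos.le, Nat.add_one_sub_one, pow_one] at hpolar
  rw [hpolar, ← integral_radialMeasure hg, ← two_mul, nsmul_eq_mul, Complex.real_smul] at hsum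
  exact mul_left_cancel₀ two_ne_zero (by exact_mod_cast hsum)

/-! ### The pair kernel of the gap process -/

open Classical in
/-- The contribution to `∫ f d(gapMeasure p)` of a point at `a` whose nearest successor is `b`. -/
noncomputable def gapKernel (f : C_c(ℝ≥0 × ℂ, ℝ)) (n : ℕ) (a b : ℂ) : ℝ :=
  if LexLE a b then f (n * nndist a b, a) else 0

/-- The characteristic factor `exp (i f) - 1` of a test function. -/
noncomputable def expFactor (f : C_c(ℝ≥0 × ℂ, ℝ)) (p : ℝ≥0 × ℂ) : ℂ :=
  Complex.exp (f p * Complex.I) - 1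

section Kernel

variable (f : C_c(ℝ≥0 × ℂ, ℝ))

theorem exists_eq_zero_of_lt : ∃ R : ℝ≥0, ∀ r z, R < r → f (r, z) = 0 := by
  obtain ⟨R, hR⟩ := f.hasCompactSupport.isCompact.bddAbove_image continuous_fst.continuousOn
  refine ⟨R, fun r z hr => image_eq_zero_of_notMem_tsupport fun h => ?_⟩
  exact absurd (hR ⟨_, h, rfl⟩) (not_le.2 hr)

theorem continuous_expFactor : Continuous (expFactor f) := by
  have := f.continuous
  unfold expFactor
  fun_prop

theorem norm_expFactor_le (p : ℝ≥0 × ℂ) : ‖expFactor f p‖ ≤ 2 :=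
  (norm_sub_le _ _).trans (by rw [Complex.norm_exp_ofReal_mul_I, norm_one]; norm_num)

theorem integrable_expFactor : Integrable (expFactor f) gapIntensity := by
  have hf : Integrable (fun p => f p) gapIntensity :=
    f.continuous.integrable_of_hasCompactSupport f.hasCompactSupport
  refine hf.norm.mono' (continuous_expFactor f).aestronglyMeasurable
    (Eventually.of_forall fun p => ?_)
  rw [expFactor, mul_comm]
  exact Real.norm_exp_I_mul_ofReal_sub_one_le

theorem measurable_gapKernel (n : ℕ) : Measurable fun p : ℂ × ℂ => gapKernel f n p.1 p.2 := by
  have hc : Continuous fun p : ℂ × ℂ => f (n * nndist p.1 p.2, p.1) :=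
    f.continuous.comp (by fun_prop)
  exact Measurable.ite measurableSet_lexLE hc.measurable measurable_const

/-- In the coordinate `u = n (b - a)` the kernel at `(a, b)` no longer depends on `n`. -/
theorem exp_gapKernel_sub_one {n : ℕ} (hn : n ≠ 0) (a u : ℂ) :
    Complex.exp (gapKernel f n a (a + (n : ℝ)⁻¹ • u) * Complex.I) - 1 =
      {u | LexLE 0 u}.indicator (fun u => expFactor f (‖u‖₊, a)) u := by
  have hn' : (0 : ℝ) < (n : ℝ)⁻¹ := inv_pos.2 (Nat.cast_pos.2 (Nat.pos_of_ne_zero hn))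
  have hn0 : (n : ℝ≥0) ≠ 0 := Nat.cast_ne_zero.2 hn
  have hiff : LexLE a (a + (n : ℝ)⁻¹ • u) ↔ LexLE 0 u := by
    rw [lexLE_sub_iff, add_sub_cancel_left, lexLE_zero_smul_iff hn']
  have hdist : (n : ℝ≥0) * nndist a (a + (n : ℝ)⁻¹ • u) = ‖u‖₊ := by
    rw [nndist_eq_nnnorm, sub_add_cancel_left, nnnorm_neg, nnnorm_smul, nnnorm_inv,
      Real.nnnorm_natCast, mul_inv_cancel_left₀ hn0]
  by_cases h : LexLE 0 u
  · rw [Set.indicator_of_mem (show u ∈ {u | LexLE 0 u} from h), gapKernel, if_pos (hiff.2 h),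
      hdist, expFactor]
  · rw [Set.indicator_of_notMem (show u ∉ {u | LexLE 0 u} from h), gapKernel,
      if_neg (mt hiff.1 h)]
    simp

/-- Only one of the two orders of a pair of different points contributes. -/
theorem pairFactor_gapKernel (n : ℕ) {a b : ℂ} (hab : a ≠ b) :
    pairFactor (gapKernel f n) a b = (Complex.exp (gapKernel f n a b * Complex.I) - 1) +
      (Complex.exp (gapKernel f n b a * Complex.I) - 1) := by
  rcases em (LexLE a b) with h | h
  · have h' : gapKernel f n b a = 0 := if_neg fun h' => hab (lexLE_antisymm h h')
    simp [pairFactor, h']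
  · have h' : gapKernel f n a b = 0 := if_neg h
    simp [pairFactor, h']

variable {f} {R : ℝ≥0}

theorem gapKernel_eq_zero (hR : ∀ r z, R < r → f (r, z) = 0) {n : ℕ} {a b : ℂ}
    (h : R < n * nndist a b) : gapKernel f n a b = 0 := by
  rw [gapKernel, hR _ _ h, ite_self]

theorem lt_mul_nndist_of_notMem {n : ℕ} (hn : n ≠ 0) {a b : ℂ}
    (h : b ∉ Metric.closedBall a (R / n)) : R < n * nndist a b := by
  rw [Metric.mem_closedBall, not_le, dist_comm,
    div_lt_iff₀ (Nat.cast_pos.2 (Nat.pos_of_ne_zero hn)), mul_comm] at h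
  exact_mod_cast h

theorem integral_norm_pairFactor_gapKernel_le (hR : ∀ r z, R < r → f (r, z) = 0) {n : ℕ}
    (hn : n ≠ 0) (a : ℂ) :
    ∫ b, ‖pairFactor (gapKernel f n) a b‖ ∂diskLaw ≤ 2 * (R / n : ℝ) ^ 2 := by
  have hle : ∀ b, ‖pairFactor (gapKernel f n) a b‖ ≤
      (Metric.closedBall a (R / n : ℝ)).indicator (fun _ => (2 : ℝ)) b := by
    intro b
    by_cases hb : b ∈ Metric.closedBall a (R / n : ℝ)
    · rw [Set.indicator_of_mem hb]
      exact norm_pairFactor_le a b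
    · have h := lt_mul_nndist_of_notMem hn hb
      rw [Set.indicator_of_notMem hb, pairFactor, gapKernel_eq_zero hR h,
        gapKernel_eq_zero hR (nndist_comm a b ▸ h)]
      simp
  have hm := measurable_pairFactor (measurable_gapKernel f n)
  have hint : Integrable (fun b => ‖pairFactor (gapKernel f n) a b‖) diskLaw :=
    (Integrable.of_bound (hm.comp (measurable_const.prodMk measurable_id)).aestronglyMeasurable 2
      (Eventually.of_forall fun b => norm_pairFactor_le a b)).norm
  refine (integral_mono hint ((integrable_const _).indicator
    Metric.isClosed_closedBall.measurableSet) hle).trans ?_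
  rw [integral_indicator_const _ Metric.isClosed_closedBall.measurableSet, smul_eq_mul, mul_comm]
  exact mul_le_mul_of_nonneg_left (diskLaw_real_closedBall_le a (by positivity)) zero_le_two

/-! ### The mean of a pair factor -/

/-- The substitution `b = a + u / n`. -/
theorem integral_exp_gapKernel_sub_one {n : ℕ} (hn : n ≠ 0) (a : ℂ) :
    (n : ℂ) ^ 2 * ∫ b, (Complex.exp (gapKernel f n a b * Complex.I) - 1) ∂diskLaw =
      (Real.pi : ℂ)⁻¹ * ∫ u : ℂ, {u | a + (n : ℝ)⁻¹ • u ∈ Metric.ball (0 : ℂ) 1}.indicator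
        ({u | LexLE 0 u}.indicator fun u => expFactor f (‖u‖₊, a)) u := by
  set g : ℂ → ℂ := fun b => Complex.exp (gapKernel f n a b * Complex.I) - 1
  have h1 : ∀ u : ℂ, {u | a + (n : ℝ)⁻¹ • u ∈ Metric.ball (0 : ℂ) 1}.indicator
      ({u | LexLE 0 u}.indicator fun u => expFactor f (‖u‖₊, a)) u =
        (Metric.ball (0 : ℂ) 1).indicator g (a + (n : ℝ)⁻¹ • u) := by
    intro u
    rw [show ({u | LexLE 0 u}.indicator fun u => expFactor f (‖u‖₊, a)) =
      fun u => g (a + (n : ℝ)⁻¹ • u) from funext fun u => (exp_gapKernel_sub_one f hn a u).symm]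
    rfl
  simp_rw [h1]
  rw [Measure.integral_comp_smul volume fun u => (Metric.ball (0 : ℂ) 1).indicator g (a + u),
    integral_add_left_eq_self fun u => (Metric.ball (0 : ℂ) 1).indicator g u,
    integral_indicator Metric.isOpen_ball.measurableSet, integral_diskLaw,
    Complex.finrank_real_complex, Complex.real_smul, Complex.real_smul, inv_pow, inv_inv,
    abs_of_nonneg (by positivity)]
  push_cast
  ring

/-- The number of pairs times the mean of a pair factor converges to the exponent of the
characteristic functional of the Poisson process. -/
theorem tendsto_integral_pairFactor_gapKernel (f : C_c(ℝ≥0 × ℂ, ℝ)) :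
    Tendsto (fun n : ℕ => (n * (n - 1) / 2 : ℂ) *
      ∫ p, pairFactor (gapKernel f n) p.1 p.2 ∂diskLaw.prod diskLaw) atTop
      (𝓝 (∫ p, expFactor f p ∂gapIntensity)) := by
  obtain ⟨R, hR⟩ := exists_eq_zero_of_lt f
  let D : Set ℂ := Metric.ball 0 1
  let H : Set ℂ := {u | LexLE 0 u}
  have hD : IsOpen D := Metric.isOpen_ball
  have hH : MeasurableSet H := measurableSet_lexLE.preimage
    (measurable_const.prodMk measurable_id)
  let hF : ℂ → ℂ → ℂ := fun a => H.indicator fun u => expFactor f (‖u‖₊, a)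
  let J : ℕ → ℂ → ℂ := fun n a => ∫ u : ℂ, {u | a + (n : ℝ)⁻¹ • u ∈ D}.indicator (hF a) u
  let bound : ℂ → ℝ := (Metric.closedBall (0 : ℂ) R).indicator fun _ => 2
  have hbound : Integrable bound := (integrable_indicator_iff
    Metric.isClosed_closedBall.measurableSet).2 (integrableOn_const measure_closedBall_lt_top.ne)
  have hcont : ∀ a, Continuous fun u : ℂ => expFactor f (‖u‖₊, a) := fun a =>
    (continuous_expFactor f).comp (by fun_prop)
  have hle : ∀ a u, ‖expFactor f (‖u‖₊, a)‖ ≤ bound u := by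
    intro a u
    by_cases hu : u ∈ Metric.closedBall (0 : ℂ) (R : ℝ)
    · simp only [bound, Set.indicator_of_mem hu]
      exact norm_expFactor_le f _
    · simp only [bound, Set.indicator_of_notMem hu]
      rw [mem_closedBall_zero_iff, not_le] at hu
      rw [expFactor, hR _ _ hu]
      simp
  have hFle : ∀ a u, ‖hF a u‖ ≤ bound u := fun a u =>
    (norm_indicator_le_norm_self _ _).trans (hle a u)
  have hJle : ∀ n a, ‖J n a‖ ≤ ∫ u, bound u := fun n a =>
    norm_integral_le_of_norm_le hbound (Eventually.of_forall fun u =>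
      (norm_indicator_le_norm_self _ _).trans (hFle a u))
  have hFm : ∀ a, Measurable (hF a) := fun a => (hcont a).measurable.indicator hH
  -- as `n → ∞`, the restriction that `a + u / n` lies in the disk disappears
  have hJlim : ∀ a ∈ D, Tendsto (fun n => J n a) atTop (𝓝 (∫ u, hF a u)) := by
    intro a ha
    refine tendsto_integral_of_dominated_convergence bound (fun n => ?_) hbound
      (fun n => Eventually.of_forall fun u =>
        (norm_indicator_le_norm_self _ _).trans (hFle a u)) (Eventually.of_forall fun u => ?_)
    · refine ((hFm a).indicator ?_).aestronglyMeasurable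
      exact (hD.preimage (by fun_prop : Continuous fun u : ℂ =>
        a + (n : ℝ)⁻¹ • u)).measurableSet
    · have hlim : Tendsto (fun n : ℕ => a + (n : ℝ)⁻¹ • u) atTop (𝓝 (a + (0 : ℝ) • u)) :=
        tendsto_const_nhds.add (tendsto_inv_atTop_nhds_zero_nat.smul_const u)
      rw [zero_smul, add_zero] at hlim
      refine tendsto_nhds_of_eventually_eq ?_
      filter_upwards [hlim (hD.mem_nhds ha)] with n hn
      exact Set.indicator_of_mem (show u ∈ {u | a + (n : ℝ)⁻¹ • u ∈ D} from hn) _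
  let g : ℕ → ℂ → ℂ → ℂ := fun n a b => Complex.exp (gapKernel f n a b * Complex.I) - 1
  have hgm : ∀ n, Measurable fun p : ℂ × ℂ => g n p.1 p.2 := fun n => by
    have := measurable_gapKernel f n
    fun_prop
  have hgint : ∀ n, Integrable (fun p : ℂ × ℂ => g n p.1 p.2) (diskLaw.prod diskLaw) := fun n =>
    Integrable.of_bound (hgm n).aestronglyMeasurable 2 (Eventually.of_forall fun p =>
      (norm_sub_le _ _).trans (by rw [Complex.norm_exp_ofReal_mul_I, norm_one]; norm_num))
  have hJg : ∀ n ≠ 0, ∀ a, J n a = Real.pi * ((n : ℂ) ^ 2 * ∫ b, g n a b ∂diskLaw) := by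
    intro n hn a
    rw [integral_exp_gapKernel_sub_one hn, mul_inv_cancel_left₀
      (Complex.ofReal_ne_zero.2 Real.pi_ne_zero)]
  have hae : ∀ᵐ a ∂diskLaw, a ∈ D := by
    rw [diskLaw]
    exact Measure.ae_smul_measure (ae_restrict_mem hD.measurableSet) _
  have hJint : Tendsto (fun n => ∫ a, J n a ∂diskLaw) atTop
      (𝓝 (∫ a, (∫ u, hF a u) ∂diskLaw)) := by
    refine tendsto_integral_filter_of_dominated_convergence (fun _ => ∫ u, bound u) ?_
      (Eventually.of_forall fun n => Eventually.of_forall (hJle n)) (integrable_const _)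
      (hae.mono hJlim)
    filter_upwards [eventually_ne_atTop 0] with n hn
    rw [show J n = fun a => (Real.pi : ℂ) * ((n : ℂ) ^ 2 * ∫ b, g n a b ∂diskLaw) from
      funext (hJg n hn)]
    exact (((hgm n).stronglyMeasurable.integral_prod_right.const_mul _).const_mul
      _).aestronglyMeasurable
  have hlimit : ∫ a, (∫ u, hF a u) ∂diskLaw = Real.pi * ∫ p, expFactor f p ∂gapIntensity := by
    have h1 : ∀ a, ∫ u, hF a u = Real.pi * ∫ r, expFactor f (r, a) ∂radialMeasure := fun a =>
      integral_lexLE_zero_norm (g := fun r => expFactor f (r, a))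
        ((continuous_expFactor f).comp (Continuous.prodMk_left a)).measurable
        (hbound.mono' (hcont a).aestronglyMeasurable (Eventually.of_forall (hle a)))
    simp_rw [h1]
    rw [integral_const_mul, gapIntensity_eq_prod, integral_prod_symm]
    exact integrable_expFactor f
  have hγ : ∀ n, ∫ p, pairFactor (gapKernel f n) p.1 p.2 ∂diskLaw.prod diskLaw =
      2 * ∫ a, ∫ b, g n a b ∂diskLaw ∂diskLaw := by
    intro n
    have hs : ∀ a, Integrable (fun b => g n a b) diskLaw := fun a =>
      Integrable.of_bound ((hgm n).comp (measurable_const.prodMk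
        measurable_id)).aestronglyMeasurable 2 (Eventually.of_forall fun p =>
        (norm_sub_le _ _).trans (by rw [Complex.norm_exp_ofReal_mul_I, norm_one]; norm_num))
    have hs' : ∀ a, Integrable (fun b => g n b a) diskLaw := fun a =>
      Integrable.of_bound ((hgm n).comp (measurable_id.prodMk
        measurable_const)).aestronglyMeasurable 2 (Eventually.of_forall fun p =>
        (norm_sub_le _ _).trans (by rw [Complex.norm_exp_ofReal_mul_I, norm_one]; norm_num))
    have hin : ∀ a, ∫ b, pairFactor (gapKernel f n) a b ∂diskLaw =
        ∫ b, g n a b ∂diskLaw + ∫ b, g n b a ∂diskLaw := by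
      intro a
      rw [← integral_add (hs a) (hs' a)]
      have hne : ∀ᵐ b ∂diskLaw, a ≠ b := by
        have : diskLaw {a} = 0 := by simp [diskLaw]
        filter_upwards [measure_eq_zero_iff_ae_notMem.1 this] with b hb h
        exact hb h.symm
      refine integral_congr_ae ?_
      filter_upwards [hne] with b hb
      exact pairFactor_gapKernel f n hb
    rw [integral_prod _ (integrable_pairFactor (measurable_gapKernel f n) _)]
    simp_rw [hin]
    rw [integral_add (hgint n).integral_prod_left (hgint n).integral_prod_right,
      integral_integral_swap (f := fun a b => g n b a) (hgint n).swap, two_mul]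
  have hfinal : Tendsto (fun n : ℕ => (1 - (n : ℂ)⁻¹) *
      ((Real.pi : ℂ)⁻¹ * ∫ a, J n a ∂diskLaw)) atTop
      (𝓝 (∫ p, expFactor f p ∂gapIntensity)) := by
    have h := (tendsto_const_nhds (x := (1 : ℂ))).sub
      (tendsto_inv_atTop_nhds_zero_nat (𝕜 := ℂ)) |>.mul (hJint.const_mul (Real.pi : ℂ)⁻¹)
    rwa [hlimit, inv_mul_cancel_left₀ (Complex.ofReal_ne_zero.2 Real.pi_ne_zero), sub_zero,
      one_mul] at h
  refine hfinal.congr' ?_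
  filter_upwards [eventually_ne_atTop 0] with n hn
  have hn' : (n : ℂ) ≠ 0 := Nat.cast_ne_zero.2 hn
  simp_rw [hγ, hJg n hn]
  rw [integral_const_mul, integral_const_mul, inv_mul_cancel_left₀
    (Complex.ofReal_ne_zero.2 Real.pi_ne_zero)]
  field_simp

end Kernel

/-! ### The gap process -/

theorem mem_lexSuccessors {n : ℕ} (p : Fin n → ℂ) (i j : Fin n) :
    j ∈ lexSuccessors p i ↔ j ≠ i ∧ LexLE (p i) (p j) := by
  simp [lexSuccessors]

open Classical in
theorem integral_gapMeasure {n : ℕ} (p : Fin n → ℂ) (f : C_c(ℝ≥0 × ℂ, ℝ)) :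
    ∫ y, f y ∂gapMeasure p = ∑ i : Fin n, if h : (lexSuccessors p i).Nonempty then
      f ((n : ℝ≥0) * lexGap p i h, p i) else 0 := by
  rw [gapMeasure, integral_finsetSum_measure]
  · refine Finset.sum_congr rfl fun i _ => ?_
    split_ifs
    · exact integral_dirac _ _
    · exact integral_zero_measure _
  · intro i _
    split_ifs
    · exact f.continuous.integrable_of_hasCompactSupport f.hasCompactSupport
    · exact integrable_zero_measure

/-- Distinct indices `i`, `j`, `l` such that `p j` and `p l` are both within `R / n` of `p i`. -/
def HasCloseTriple {n : ℕ} (R : ℝ≥0) (p : Fin n → ℂ) : Prop :=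
  ∃ i j l : Fin n, i ≠ j ∧ i ≠ l ∧ j ≠ l ∧ (n : ℝ≥0) * nndist (p i) (p j) ≤ R ∧
    (n : ℝ≥0) * nndist (p i) (p l) ≤ R

/-- As long as no point is close to two others, only the nearest successor of a point contributes
to the sum over pairs. -/
theorem integral_gapMeasure_eq_pairSum {f : C_c(ℝ≥0 × ℂ, ℝ)} {R : ℝ≥0}
    (hR : ∀ r z, R < r → f (r, z) = 0) {n : ℕ} {p : Fin n → ℂ} (hp : ¬ HasCloseTriple R p) :
    ∫ y, f y ∂gapMeasure p = pairSum (gapKernel f n) p Finset.univ := by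
  classical
  rw [integral_gapMeasure, pairSum]
  refine Finset.sum_congr rfl fun i _ => ?_
  have hsum : ∑ j, (if i = j then 0 else gapKernel f n (p i) (p j)) =
      ∑ j ∈ lexSuccessors p i, f (n * nndist (p i) (p j), p i) := by
    rw [← Finset.sum_subset (Finset.subset_univ (lexSuccessors p i))]
    · refine Finset.sum_congr rfl fun j hj => ?_
      rw [mem_lexSuccessors] at hj
      rw [if_neg hj.1.symm, gapKernel, if_pos hj.2]
    · intro j _ hj
      rw [mem_lexSuccessors, not_and] at hj
      split_ifs with h
      · rfl
      · exact if_neg (hj (Ne.symm h))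
  rw [hsum]
  split_ifs with h
  · obtain ⟨j, hj, hgap⟩ := Finset.exists_mem_eq_inf' h fun j => nndist (p i) (p j)
    rw [lexGap, hgap, Finset.sum_eq_single_of_mem j hj]
    intro l hl hlj
    by_contra hne
    have hlR : (n : ℝ≥0) * nndist (p i) (p l) ≤ R := not_lt.1 fun hlt => hne (hR _ _ hlt)
    have hjl : nndist (p i) (p j) ≤ nndist (p i) (p l) := hgap ▸ Finset.inf'_le _ hl
    exact hp ⟨i, j, l, ((mem_lexSuccessors p i j).1 hj).1.symm,
      ((mem_lexSuccessors p i l).1 hl).1.symm, hlj.symm,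
      (mul_le_mul_right hjl _).trans hlR, hlR⟩
  · rw [Finset.not_nonempty_iff_eq_empty.1 h, Finset.sum_empty]

theorem measurable_gapProcess (n : ℕ) : Measurable (gapProcess : (Fin n → ℂ) → _) := by
  classical
  refine LocallyFiniteMeasure.measurable_of_integral fun f => ?_
  change Measurable fun p : Fin n → ℂ => ∫ y, f y ∂gapMeasure p
  -- on the event that the set of successors of `i` is `T`, the summand of `i` is continuous
  have h : ∀ p : Fin n → ℂ, ∫ y, f y ∂gapMeasure p = ∑ i : Fin n, ∑ T : Finset (Fin n),
      if lexSuccessors p i = T then (if hT : T.Nonempty then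
        f ((n : ℝ≥0) * T.inf' hT fun j => nndist (p i) (p j), p i) else 0) else 0 := by
    intro p
    rw [integral_gapMeasure]
    refine Finset.sum_congr rfl fun i _ => ?_
    rw [Finset.sum_ite_eq]
    simp only [Finset.mem_univ, if_true]
    rfl
  simp_rw [h]
  refine Finset.measurable_sum _ fun i _ => Finset.measurable_sum _ fun T _ => ?_
  refine Measurable.ite ?_ ?_ measurable_const
  · have hset : {p : Fin n → ℂ | lexSuccessors p i = T} =
        ⋂ j, {p | (j ≠ i ∧ LexLE (p i) (p j)) ↔ j ∈ T} := by
      ext p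
      simp [Finset.ext_iff, mem_lexSuccessors]
    rw [hset]
    refine MeasurableSet.iInter fun j => ?_
    have hij : Measurable fun p : Fin n → ℂ => (p i, p j) := by fun_prop
    have hle : MeasurableSet {p : Fin n → ℂ | LexLE (p i) (p j)} :=
      measurableSet_lexLE.preimage hij
    exact measurableSet_setOfPred.2 (((measurable_const (a := j ≠ i)).and
      (measurableSet_setOfPred.1 hle)).iff measurable_const)
  · split_ifs with hT
    · refine (f.continuous.comp (Continuous.prodMk (continuous_const.mul
        (Continuous.finset_inf'_apply hT fun j _ => ?_)) (continuous_apply i))).measurable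
      exact (continuous_apply i).nndist (continuous_apply j)
    · exact measurable_const

/-- The indicator of the pairs at distance at most `R / n`. -/
noncomputable def closeIndicator (R : ℝ≥0) (n : ℕ) (a b : ℂ) : ℝ :=
  (Metric.closedBall a (R / n : ℝ)).indicator (fun _ => (1 : ℝ)) b

theorem measurable_closeIndicator (R : ℝ≥0) (n : ℕ) :
    Measurable fun p : ℂ × ℂ => closeIndicator R n p.1 p.2 := by
  have hset : MeasurableSet {p : ℂ × ℂ | p.2 ∈ Metric.closedBall p.1 (R / n : ℝ)} :=
    (isClosed_le (by fun_prop : Continuous fun p : ℂ × ℂ => dist p.2 p.1)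
      continuous_const).measurableSet
  exact (measurable_const (a := (1 : ℝ))).indicator hset

theorem closeIndicator_nonneg (R : ℝ≥0) (n : ℕ) (a b : ℂ) : 0 ≤ closeIndicator R n a b :=
  Set.indicator_nonneg (fun _ _ => zero_le_one) _

theorem closeIndicator_le_one (R : ℝ≥0) (n : ℕ) (a b : ℂ) : closeIndicator R n a b ≤ 1 :=
  Set.indicator_le' (fun _ _ => le_rfl) (fun _ _ => zero_le_one) _

theorem integral_closeIndicator_le (R : ℝ≥0) (n : ℕ) (a : ℂ) :
    ∫ b, closeIndicator R n a b ∂diskLaw ≤ (R / n : ℝ) ^ 2 := by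
  unfold closeIndicator
  rw [integral_indicator_const _ Metric.isClosed_closedBall.measurableSet, smul_eq_mul, mul_one]
  exact diskLaw_real_closedBall_le a (by positivity)

/-- The law of `n` independent uniform points in the disk. -/
noncomputable def diskSampleLaw (n : ℕ) : Measure (Fin n → ℂ) := Measure.pi fun _ => diskLaw

instance (n : ℕ) : IsProbabilityMeasure (diskSampleLaw n) := by
  unfold diskSampleLaw
  infer_instance

theorem map_eval_diskSampleLaw {n : ℕ} (i : Fin n) :
    (diskSampleLaw n).map (fun p => p i) = diskLaw :=
  (measurePreserving_eval (fun _ : Fin n => diskLaw) i).map_eq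

theorem iIndepFun_eval_diskSampleLaw (n : ℕ) :
    iIndepFun (fun (i : Fin n) (p : Fin n → ℂ) => p i) (diskSampleLaw n) :=
  iIndepFun_pi (X := fun _ z => z) fun _ => aemeasurable_id

/-- The characteristic functional of the gap process differs from that of the sum over all pairs
by at most twice the expected number of close triples. -/
theorem norm_integral_exp_gapMeasure_sub_le {f : C_c(ℝ≥0 × ℂ, ℝ)} {R : ℝ≥0}
    (hR : ∀ r z, R < r → f (r, z) = 0) {n : ℕ} (hn : n ≠ 0) :
    ‖∫ p, Complex.exp ((∫ y, f y ∂gapMeasure p : ℝ) * Complex.I) ∂diskSampleLaw n -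
      pairCharFun (gapKernel f n) (fun (i : Fin n) (p : Fin n → ℂ) => p i) (diskSampleLaw n)
        Finset.univ‖ ≤ 2 * (n ^ 3 * ((R / n : ℝ) ^ 2) ^ 2) := by
  have hm1 : Measurable fun p : Fin n → ℂ => ∫ y, f y ∂gapMeasure p :=
    (LocallyFiniteMeasure.continuous_integral f).measurable.comp (measurable_gapProcess n)
  have hm2 := measurable_pairSum (x := fun (i : Fin n) (p : Fin n → ℂ) => p i)
    (measurable_gapKernel f n) Finset.univ fun i _ => measurable_pi_apply i
  have hi1 : Integrable (fun p : Fin n → ℂ =>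
      Complex.exp ((∫ y, f y ∂gapMeasure p : ℝ) * Complex.I)) (diskSampleLaw n) :=
    Integrable.of_bound (Measurable.aestronglyMeasurable (by fun_prop)) 1
      (Eventually.of_forall fun p => (Complex.norm_exp_ofReal_mul_I _).le)
  have hi2 : Integrable (fun p : Fin n → ℂ =>
      Complex.exp (pairSum (gapKernel f n) (fun i => p i) Finset.univ * Complex.I))
      (diskSampleLaw n) :=
    Integrable.of_bound (Measurable.aestronglyMeasurable (by fun_prop)) 1
      (Eventually.of_forall fun p => (Complex.norm_exp_ofReal_mul_I _).le)
  let c : Fin n → Fin n → Fin n → (Fin n → ℂ) → ℝ := fun i j l p =>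
    if i ≠ j ∧ i ≠ l ∧ j ≠ l then
      closeIndicator R n (p i) (p j) * closeIndicator R n (p i) (p l) else 0
  have hc0 : ∀ i j l p, 0 ≤ c i j l p := fun i j l p => by
    simp only [c]
    split_ifs
    · exact mul_nonneg (closeIndicator_nonneg _ _ _ _) (closeIndicator_nonneg _ _ _ _)
    · exact le_rfl
  have hcint : ∀ i j l, Integrable (c i j l) (diskSampleLaw n) := by
    intro i j l
    by_cases h : i ≠ j ∧ i ≠ l ∧ j ≠ l
    · simp only [c, if_pos h]
      have hm := fun a b : Fin n => (measurable_closeIndicator R n).comp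
        ((measurable_pi_apply (X := fun _ : Fin n => ℂ) a).prodMk (measurable_pi_apply b))
      refine Integrable.of_bound ((hm i j).mul (hm i l)).aestronglyMeasurable (1 * 1)
        (Eventually.of_forall fun p => ?_)
      rw [Real.norm_of_nonneg (mul_nonneg (closeIndicator_nonneg _ _ _ _)
        (closeIndicator_nonneg _ _ _ _))]
      exact mul_le_mul (closeIndicator_le_one _ _ _ _) (closeIndicator_le_one _ _ _ _)
        (closeIndicator_nonneg _ _ _ _) zero_le_one
    · simp only [c, if_neg h]
      exact integrable_const _
  have hcle : ∀ i j l, ∫ p, c i j l p ∂diskSampleLaw n ≤ ((R / n : ℝ) ^ 2) ^ 2 := by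
    intro i j l
    by_cases h : i ≠ j ∧ i ≠ l ∧ j ≠ l
    · simp only [c, if_pos h]
      exact integral_mul_pair_le (x := fun (i : Fin n) (p : Fin n → ℂ) => p i)
        (fun i => measurable_pi_apply i) map_eval_diskSampleLaw (iIndepFun_eval_diskSampleLaw n)
        (measurable_closeIndicator R n) (closeIndicator_nonneg R n) (closeIndicator_le_one R n)
        (integral_closeIndicator_le R n) h.1 h.2.1 h.2.2
    · simp only [c, if_neg h, integral_zero]
      positivity
  have hpoint : ∀ p : Fin n → ℂ,
      ‖Complex.exp ((∫ y, f y ∂gapMeasure p : ℝ) * Complex.I) -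
        Complex.exp (pairSum (gapKernel f n) (fun i => p i) Finset.univ * Complex.I)‖ ≤
      2 * ∑ i, ∑ j, ∑ l, c i j l p := by
    intro p
    by_cases hp : HasCloseTriple R p
    · obtain ⟨i, j, l, hij, hil, hjl, h1, h2⟩ := hp
      have hclose : ∀ a, (n : ℝ≥0) * nndist (p i) a ≤ R → closeIndicator R n (p i) a = 1 := by
        intro a ha
        refine Set.indicator_of_mem ?_ _
        by_contra h
        exact absurd (lt_mul_nndist_of_notMem hn h) (not_lt.2 ha)
      have hone : c i j l p = 1 := by
        simp only [c, if_pos (show i ≠ j ∧ i ≠ l ∧ j ≠ l from ⟨hij, hil, hjl⟩), hclose _ h1,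
          hclose _ h2, one_mul]
      have hge : 1 ≤ ∑ i, ∑ j, ∑ l, c i j l p := by
        rw [← hone]
        refine le_trans ?_ (Finset.single_le_sum (f := fun i => ∑ j, ∑ l, c i j l p)
          (fun i _ => Finset.sum_nonneg fun j _ => Finset.sum_nonneg fun l _ => hc0 i j l p)
          (Finset.mem_univ i))
        refine le_trans ?_ (Finset.single_le_sum (f := fun j => ∑ l, c i j l p)
          (fun j _ => Finset.sum_nonneg fun l _ => hc0 i j l p) (Finset.mem_univ j))
        exact Finset.single_le_sum (f := fun l => c i j l p) (fun l _ => hc0 i j l p)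
          (Finset.mem_univ l)
      refine (norm_sub_le _ _).trans ?_
      rw [Complex.norm_exp_ofReal_mul_I, Complex.norm_exp_ofReal_mul_I]
      linarith
    · rw [integral_gapMeasure_eq_pairSum hR hp, sub_self, norm_zero]
      exact mul_nonneg zero_le_two (Finset.sum_nonneg fun i _ => Finset.sum_nonneg fun j _ =>
        Finset.sum_nonneg fun l _ => hc0 i j l p)
  rw [pairCharFun, ← integral_sub hi1 hi2]
  refine (norm_integral_le_of_norm_le (Integrable.const_mul (integrable_finsetSum _ fun i _ =>
    integrable_finsetSum _ fun j _ => integrable_finsetSum _ fun l _ => hcint i j l) 2)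
    (Eventually.of_forall hpoint)).trans ?_
  rw [integral_const_mul, integral_finsetSum _ fun i _ =>
    integrable_finsetSum _ fun j _ => integrable_finsetSum _ fun l _ => hcint i j l]
  refine mul_le_mul_of_nonneg_left ?_ zero_le_two
  calc ∑ i, ∫ p, ∑ j, ∑ l, c i j l p ∂diskSampleLaw n
      = ∑ i, ∑ j, ∑ l, ∫ p, c i j l p ∂diskSampleLaw n := by
        refine Finset.sum_congr rfl fun i _ => ?_
        rw [integral_finsetSum _ fun j _ => integrable_finsetSum _ fun l _ => hcint i j l]
        exact Finset.sum_congr rfl fun j _ => integral_finsetSum _ fun l _ => hcint i j l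
    _ ≤ ∑ _i : Fin n, ∑ _j : Fin n, ∑ _l : Fin n, ((R / n : ℝ) ^ 2) ^ 2 :=
        Finset.sum_le_sum fun i _ => Finset.sum_le_sum fun j _ => Finset.sum_le_sum fun l _ =>
          hcle i j l
    _ = n ^ 3 * ((R / n : ℝ) ^ 2) ^ 2 := by
        simp only [Finset.sum_const, Finset.card_univ, Fintype.card_fin, nsmul_eq_mul]
        ring

/-! ### Convergence of the characteristic functionals -/

theorem tendsto_integral_exp_gapMeasure (f : C_c(ℝ≥0 × ℂ, ℝ)) :
    Tendsto (fun n => ∫ p, Complex.exp ((∫ y, f y ∂gapMeasure p : ℝ) * Complex.I)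
      ∂diskSampleLaw n) atTop (𝓝 (Complex.exp (∫ p, expFactor f p ∂gapIntensity))) := by
  obtain ⟨R, hR⟩ := exists_eq_zero_of_lt f
  have hexp : Tendsto (fun n : ℕ => Complex.exp ((n * (n - 1) / 2 : ℂ) *
      ∫ p, pairFactor (gapKernel f n) p.1 p.2 ∂diskLaw.prod diskLaw)) atTop
      (𝓝 (Complex.exp (∫ p, expFactor f p ∂gapIntensity))) :=
    (Complex.continuous_exp.tendsto _).comp (tendsto_integral_pairFactor_gapKernel f)
  have herr : Tendsto (fun n : ℕ => 18 * (R : ℝ) ^ 4 * (n : ℝ)⁻¹) atTop (𝓝 0) := by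
    simpa only [mul_zero] using
      (tendsto_inv_atTop_nhds_zero_nat (𝕜 := ℝ)).const_mul (18 * (R : ℝ) ^ 4)
  have hsmall : ∀ᶠ n : ℕ in atTop, 2 * (R : ℝ) ^ 2 * (n : ℝ)⁻¹ ≤ 1 := by
    have h : Tendsto (fun n : ℕ => 2 * (R : ℝ) ^ 2 * (n : ℝ)⁻¹) atTop (𝓝 0) := by
      simpa only [mul_zero] using
      (tendsto_inv_atTop_nhds_zero_nat (𝕜 := ℝ)).const_mul (2 * (R : ℝ) ^ 2)
    exact h.eventually_le_const one_pos
  have hdiff := squeeze_zero_norm' (f := fun n : ℕ =>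
    ∫ p, Complex.exp ((∫ y, f y ∂gapMeasure p : ℝ) * Complex.I) ∂diskSampleLaw n -
      Complex.exp ((n * (n - 1) / 2 : ℂ) *
        ∫ p, pairFactor (gapKernel f n) p.1 p.2 ∂diskLaw.prod diskLaw)) ?_ herr
  · simpa using hdiff.add hexp
  filter_upwards [eventually_ne_atTop 0, hsmall] with n hn hn1
  have hn' : (n : ℝ) ≠ 0 := Nat.cast_ne_zero.2 hn
  have h1 := norm_integral_exp_gapMeasure_sub_le hR hn
  have h2 := norm_pairCharFun_sub_exp_le (x := fun (i : Fin n) (p : Fin n → ℂ) => p i)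
    (measurable_gapKernel f n) (fun i => measurable_pi_apply i) map_eval_diskSampleLaw
    (iIndepFun_eval_diskSampleLaw n) (integral_norm_pairFactor_gapKernel_le hR hn) Finset.univ (by
      rw [Finset.card_univ, Fintype.card_fin]
      refine le_trans (le_of_eq ?_) hn1
      field_simp)
  rw [Finset.card_univ, Fintype.card_fin] at h2
  refine (norm_sub_le_norm_sub_add_norm_sub _ _ _).trans ((add_le_add h1 h2).trans_eq ?_)
  field_simp
  ring

theorem theorem2 {Ω : ℕ → Type*} [∀ n, MeasurableSpace (Ω n)]
    (P : ∀ n, Measure (Ω n)) [∀ n, IsProbabilityMeasure (P n)]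
    (φ : ∀ n, Fin n → Ω n → ℂ)
    (hindep : ∀ n, iIndepFun (φ n) (P n))
    (hunif : ∀ n i, pdf.IsUniform (φ n i) (Metric.ball (0 : ℂ) 1) (P n) volume) :
    ∃ (Ω' : Type) (_ : MeasurableSpace Ω') (P' : Measure Ω') (_ : IsProbabilityMeasure P')
      (χ : Ω' → LocallyFiniteMeasure (ℝ≥0 × ℂ)),
      IsPoissonPointProcess χ gapIntensity P' ∧
      (∀ (A : Set ℝ≥0) (I : Set ℂ), MeasurableSet A → Bornology.IsBounded A →
        MeasurableSet I → Bornology.IsBounded I →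
        ∫⁻ ω, (χ ω).toMeasure (A ×ˢ I) ∂P' =
          volume (I ∩ Metric.ball (0 : ℂ) 1) / ENNReal.ofReal Real.pi *
            ∫⁻ r in ((fun a : ℝ≥0 => (a : ℝ)) '' A), ENNReal.ofReal r) ∧
      TendstoInDistribution (fun n ω => gapProcess (fun i => φ n i ω)) atTop χ P P' := by
  obtain ⟨P', χ, hP', hχ, hcount, hmean, hchar⟩ := exists_characteristic_functional gapIntensity
  refine ⟨_, inferInstance, P', hP', χ,
    isPoissonPointProcess_of_characteristic_functional hχ hcount hmean hchar,
    fun A I hA _ hI _ => (hmean _ (hA.prod hI)).trans (gapIntensity_prod hA hI), ?_⟩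
  have hφ : ∀ n i, AEMeasurable (φ n i) (P n) := fun n i =>
    pdf.IsUniform.aemeasurable (Metric.measure_ball_pos volume 0 one_pos).ne'
      measure_ball_lt_top.ne (hunif n i)
  have hφ' : ∀ n, AEMeasurable (fun ω i => φ n i ω) (P n) := fun n =>
    aemeasurable_pi_lambda _ (hφ n)
  have hlaw : ∀ n, (P n).map (fun ω i => φ n i ω) = diskSampleLaw n := by
    intro n
    rw [(iIndepFun_iff_map_fun_eq_pi_map (hφ n)).1 (hindep n), diskSampleLaw]
    congr 1
    funext i
    rw [← cond_unitBall]
    exact hunif n i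
  refine LocallyFiniteMeasure.tendstoInDistribution_of_tendsto_charFun
    (fun n => (measurable_gapProcess n).comp_aemeasurable (hφ' n)) hχ.aemeasurable fun f => ?_
  have hf : Integrable (fun p => f p) gapIntensity :=
    f.continuous.integrable_of_hasCompactSupport f.hasCompactSupport
  rw [hchar f f.continuous.measurable hf]
  refine (tendsto_integral_exp_gapMeasure f).congr fun n => ?_
  have hm : Measurable fun p : Fin n → ℂ => ∫ y, f y ∂gapMeasure p :=
    (LocallyFiniteMeasure.continuous_integral f).measurable.comp (measurable_gapProcess n)
  rw [← hlaw n, integral_map (hφ' n) (Measurable.aestronglyMeasurable (by fun_prop))]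
  rfl
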